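/- **Theorem (new formula for entropy solutions).** Let $f\in C^2(\mathbb R)$ satisfy $f''\ge 0$ on $\mathbb R$ and $\mathcal L\{u: f''(u)=0\}=0$ ($\mathcal L$ is Lebesgue measure), and let $\varphi\in L^\infty(\mathbb R)$. Consider the Cauchy problem $$u_t+f(u)_x=0\ \text{ in }\ \mathbb R\times\mathbb R^+,\qquad u|_{t=0}=\varphi, \qquad \mathbb R^+=(0,\infty).$$ A *weak solution* is a bounded measurable function $u$ on $\mathbb R\times\mathbb R^+$ such that $\iint_{\mathbb R\times\mathbb R^+}(u\,\phi_t+f(u)\,\phi_x)\,dx\,dt=0$ for every $\phi\in C_c^\infty(\mathbb R\times\mathbb R^+)$ and $\lim_{t\to0+}\int_{x_1}^{x_2}u(x,t)\,dx=\int_{x_1}^{x_2}\varphi(x)\,dx$ for all $x_1,x_2\in\mathbb R$ (the integrals on the left existing for all sufficiently small $t>0$). An *entropy solution* is a weak solution with the Oleinik-type one-sided inequality $$f'(u(x_2,t))-f'(u(x_1,t))\le\frac{x_2-x_1}{t}\qquad\text{for all } x_2>x_1 \text{ and } t>0.$$ For $(x,t)\in\mathbb R\times\mathbb R^+$ and $u\in\mathbb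 R$ put $$E(u;x,t)=t\int_0^u f''(s)\big(\varphi(x-tf'(s))-s\big)\,ds,\qquad \mathcal U(x,t)=\Big\{w\in\mathbb R: E(w;x,t)=\max_{v\in\mathbb R}E(v;x,t)\Big\}.$$ These integrals exist and $\mathcal U(x,t)$ is non-empty and compact; let $u^-(x,t)=\sup\mathcal U(x,t)$ and $u^+(x,t)=\inf\mathcal U(x,t)$, and define $u(x,t):=u^+(x,t)$. Then: 1. $u$ is an entropy solution of the Cauchy problem, and it is the unique one: every entropy solution is equal to $u$ almost everywhere on $\mathbb R\times\mathbb R^+$. 2. For every $(x,t)\in\mathbb R\times\mathbb R^+$ the one-sided limits of $u(\cdot,t)$ at $x$ exist, and $u(x-,t)=u^-(x,t)$, $u(x+,t)=u^+(x,t)$. 3. For each $t>0$ there is an at most countable set $S_t\subset\mathbb R$ such that $u(x-,t)=u(x+,t)$ and $u(\cdot,t)$ is continuous at $x$ for every $x\notin S_t$, while $u(x-,t)>u(x+,t)$ for every $x\in S_t$. 4. $f'(u(\cdot,t))\in BV_{\rm loc}(\mathbb R)$ for every $t>0$. -/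

import Mathlib

open MeasureTheory Set Filter Topology

namespace ScalarLaw

/-- `E(u; x, t) = t ∫₀ᵘ f''(s) (φ(x - t f'(s)) - s) ds`. -/
noncomputable def E (f φ : ℝ → ℝ) (u x t : ℝ) : ℝ :=
  t * ∫ s in (0 : ℝ)..u, deriv (deriv f) s * (φ (x - t * deriv f s) - s)

/-- The set of points at which `E(· ; x, t)` attains its maximum over `ℝ`. -/
def maximizers (f φ : ℝ → ℝ) (x t : ℝ) : Set ℝ :=
  {w : ℝ | ∀ v : ℝ, E f φ v x t ≤ E f φ w x t}

/-- `u⁻(x, t)`, the supremum of the set of maximizers. -/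
noncomputable def uMinus (f φ : ℝ → ℝ) (x t : ℝ) : ℝ := sSup (maximizers f φ x t)

/-- `u⁺(x, t)`, the infimum of the set of maximizers. -/
noncomputable def uPlus (f φ : ℝ → ℝ) (x t : ℝ) : ℝ := sInf (maximizers f φ x t)

/-- The open upper half-plane `ℝ × ℝ⁺` of points `(x, t)` with `t > 0`. -/
def upperHalf : Set (ℝ × ℝ) := {p : ℝ × ℝ | 0 < p.2}

/-- Weak solutions of `u_t + f(u)_x = 0` in `ℝ × ℝ⁺`, `u(·, 0) = φ`: bounded (Lebesgue) measurable
functions that solve the equation against test functions in `C_c^∞(ℝ × ℝ⁺)` and take the initial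
data in the sense of integrals over intervals. The values of `u` at times `t ≤ 0` play no role. -/
structure IsWeakSolution (f φ : ℝ → ℝ) (u : ℝ → ℝ → ℝ) : Prop where
  bounded : ∃ M : ℝ, ∀ x t : ℝ, 0 < t → |u x t| ≤ M
  measurable : AEMeasurable (fun p : ℝ × ℝ => u p.1 p.2) (volume.restrict upperHalf)
  equation : ∀ ψ : ℝ × ℝ → ℝ, ContDiff ℝ (⊤ : ℕ∞) ψ → HasCompactSupport ψ →
    tsupport ψ ⊆ upperHalf →
    ∫ p in upperHalf,
      (u p.1 p.2 * fderiv ℝ ψ p (0, 1) + f (u p.1 p.2) * fderiv ℝ ψ p (1, 0)) = 0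
  /-- The integrals `∫_{x₁}^{x₂} u(x, t) dx` make sense for small `t > 0` and converge. -/
  initial : ∀ x₁ x₂ : ℝ,
    (∀ᶠ t in 𝓝[>] (0 : ℝ), IntervalIntegrable (fun x => u x t) volume x₁ x₂) ∧
    Tendsto (fun t => ∫ x in x₁..x₂, u x t) (𝓝[>] (0 : ℝ)) (𝓝 (∫ x in x₁..x₂, φ x))

/-- Entropy solutions: weak solutions with the Oleinik-type one-sided inequality. -/
structure IsEntropySolution (f φ : ℝ → ℝ) (u : ℝ → ℝ → ℝ) : Prop
    extends IsWeakSolution f φ u where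
  oleinik : ∀ x₁ x₂ t : ℝ, x₁ < x₂ → 0 < t →
    deriv f (u x₂ t) - deriv f (u x₁ t) ≤ (x₂ - x₁) / t

end ScalarLaw

/-!
Write `a = f'`, which is continuous and strictly increasing because `f''` vanishes only on a null
set, and let `Φ` be the primitive of `φ`. The substitution `y = x - t a(s)` turns the integral in
`E` into increments of `Φ`, so that maximizing `E(· ; x, t)` means minimizing the action
`Φ(x - t a(w)) + t ℓ(w)`, where `ℓ(w) = w a(w) - f(w)` is the Legendre transform of `f` at the slope
`a(w)` (`IsAdmissible.E_eq`). This is the Lax–Oleinik formula, parametrized by `w` instead of the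
foot `y` of the characteristic. If `|φ| ≤ M` almost everywhere, all minimizers lie in `[-M, M]`.

*Structure in `x`.* Strict convexity of `ℓ` as a function of the slope makes the feet of optimal
characteristics increase with `x` (`IsAdmissible.foot_le_foot`). Oleinik's inequality, the one-sided
limits, the countability of the jump set and the bounded variation of `f'(u(·, t))` follow from this
monotonicity and from the closedness of the set of minimizers.

*Existence.* The minimal action `V` is Lipschitz on the whole plane and `V(·, 0) = Φ`. At a point of
differentiability, comparison with curves ending on the optimal characteristic gives `V_x = w` and
`V_t = -f(w)` for every minimizer `w` (`IsAdmissible.fderiv_value`). By Rademacher's theorem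
`V_x = u` and `V_t = -f(u)` almost everywhere, and integration by parts gives the weak equation.

*Uniqueness.* A weak solution `v` makes the field `(v, -f(v))` curl-free. By mollification and the
Poincaré lemma it is the gradient of a Lipschitz function `W` (`IsCurlFree.exists_potential`), and
the initial condition of `v` gives `W(·, 0) = Φ`. Convexity of `f` bounds the growth of `W` along
every line of slope `a(c)` by `ℓ(c)`, whence `W ≤ V` (`IsAdmissible.le_value`). Conversely,
`z = V - W` satisfies `z_t + a(v) z_x ≤ 0`, again by convexity, and `z(·, 0) = 0`. The Oleinik
inequality for `v` says that `a(v)_x ≤ 1 / t`, and under this one-sided bound a weighted integral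
estimate shows `z ≤ 0` (`nonpos_of_transport`). So `W = V`, and `v = W_x = V_x = u` almost
everywhere.
-/

namespace ScalarLaw

/-! ### The flux: strict convexity and the Legendre transform -/

theorem strictMono_deriv {f : ℝ → ℝ} (hf : ContDiff ℝ 2 f)
    (hconv : ∀ u : ℝ, 0 ≤ deriv (deriv f) u)
    (hnull : volume {u : ℝ | deriv (deriv f) u = 0} = 0) : StrictMono (deriv f) := by
  have hd : Differentiable ℝ (deriv f) :=
    ((contDiff_succ_iff_deriv (n := 1)).1 (by simpa using! hf)).2.2.differentiable one_ne_zero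
  have hm : Monotone (deriv f) := monotone_of_deriv_nonneg hd hconv
  intro a b hab
  refine lt_of_le_of_ne (hm hab.le) fun h => ?_
  have hsub : Ioo a b ⊆ {u : ℝ | deriv (deriv f) u = 0} := by
    intro c hc
    have : deriv f =ᶠ[𝓝 c] fun _ => deriv f a := by
      filter_upwards [Ioo_mem_nhds hc.1 hc.2] with y hy
      exact le_antisymm ((hm hy.2.le).trans h.ge) (hm hy.1.le)
    change deriv (deriv f) c = 0
    rw [this.deriv_eq, deriv_const]
  have := measure_mono_null hsub hnull
  simp only [Real.volume_Ioo, ENNReal.ofReal_eq_zero, sub_nonpos] at this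
  exact absurd hab this.not_gt

/-- The Legendre transform of `f` at the slope `f'(w)`, as a function of `w`. -/
noncomputable def legendre (f : ℝ → ℝ) (w : ℝ) : ℝ := w * deriv f w - f w

theorem tangent_lt {f : ℝ → ℝ} (hf : Differentiable ℝ f) (ha : StrictMono (deriv f)) {v w : ℝ}
    (h : v ≠ w) : f w + deriv f w * (v - w) < f v := by
  rcases lt_or_gt_of_ne h with h | h
  · obtain ⟨c, hc, hc'⟩ := exists_deriv_eq_slope f h hf.continuous.continuousOn
      hf.differentiableOn
    have := ha hc.2
    rw [hc', div_lt_iff₀ (by linarith)] at this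
    linarith
  · obtain ⟨c, hc, hc'⟩ := exists_deriv_eq_slope f h hf.continuous.continuousOn
      hf.differentiableOn
    have := ha hc.1
    rw [hc', lt_div_iff₀ (by linarith)] at this
    linarith

theorem tangent_le {f : ℝ → ℝ} (hf : Differentiable ℝ f) (ha : StrictMono (deriv f)) (v w : ℝ) :
    f w + deriv f w * (v - w) ≤ f v := by
  rcases eq_or_ne v w with rfl | h
  · simp
  · exact (tangent_lt hf ha h).le

theorem mul_sub_lt_legendre_sub {f : ℝ → ℝ} (hf : Differentiable ℝ f) (ha : StrictMono (deriv f))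
    {v w : ℝ} (h : v ≠ w) :
    v * (deriv f w - deriv f v) < legendre f w - legendre f v := by
  have := tangent_lt hf ha h
  unfold legendre
  linarith

theorem mul_sub_le_legendre_sub {f : ℝ → ℝ} (hf : Differentiable ℝ f) (ha : StrictMono (deriv f))
    (v w : ℝ) : v * (deriv f w - deriv f v) ≤ legendre f w - legendre f v := by
  rcases eq_or_ne v w with rfl | h
  · simp
  · exact (mul_sub_lt_legendre_sub hf ha h).le

/-! ### The action and its minimizers -/

/-- The primitive of the initial datum that vanishes at `0`. -/
noncomputable def prim (φ : ℝ → ℝ) (y : ℝ) : ℝ := ∫ s in (0 : ℝ)..y, φ s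

/-- The function minimized by the Lax–Oleinik formula, parametrized by the value `w` of the
solution instead of the foot `x - t f'(w)` of the characteristic line. -/
noncomputable def action (f φ : ℝ → ℝ) (w x t : ℝ) : ℝ :=
  prim φ (x - t * deriv f w) + t * legendre f w

/-- The standing assumptions, with an explicit essential bound `M` for the initial datum. The
hypotheses on `f''` enter only through the strict monotonicity of `f'`. -/
structure IsAdmissible (f φ : ℝ → ℝ) (M : ℝ) : Prop where
  contDiff : ContDiff ℝ 2 f
  strictMono : StrictMono (deriv f)
  memLp : MemLp φ ⊤ volume
  nonneg : 0 ≤ M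
  bound : ∀ᵐ x, |φ x| ≤ M

theorem exists_isAdmissible {f φ : ℝ → ℝ} (hf : ContDiff ℝ 2 f)
    (hconv : ∀ u : ℝ, 0 ≤ deriv (deriv f) u)
    (hnull : volume {u : ℝ | deriv (deriv f) u = 0} = 0)
    (hφ : MemLp φ ⊤ volume) : ∃ M : ℝ, IsAdmissible f φ M := by
  refine ⟨(eLpNorm φ ⊤ volume).toReal, hf, strictMono_deriv hf hconv hnull, hφ,
    ENNReal.toReal_nonneg, ?_⟩
  have h := ae_le_eLpNormEssSup (f := φ) (μ := volume)
  filter_upwards [h] with x hx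
  rw [← eLpNorm_exponent_top] at hx
  have := ENNReal.toReal_mono hφ.eLpNorm_ne_top hx
  simpa using this

namespace IsAdmissible

variable {f φ : ℝ → ℝ} {M : ℝ}

theorem differentiable (h : IsAdmissible f φ M) : Differentiable ℝ f :=
  h.contDiff.differentiable two_ne_zero

theorem contDiff_deriv (h : IsAdmissible f φ M) : ContDiff ℝ 1 (deriv f) :=
  ((contDiff_succ_iff_deriv (n := 1)).1 (by simpa using! h.contDiff)).2.2

theorem continuous_deriv (h : IsAdmissible f φ M) : Continuous (deriv f) :=
  h.contDiff_deriv.continuous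

theorem hasDerivAt_deriv (h : IsAdmissible f φ M) (s : ℝ) :
    HasDerivAt (deriv f) (deriv (deriv f) s) s :=
  (h.contDiff_deriv.differentiable one_ne_zero s).hasDerivAt

theorem continuous_deriv_deriv (h : IsAdmissible f φ M) : Continuous (deriv (deriv f)) :=
  h.contDiff_deriv.continuous_deriv le_rfl

theorem continuous_legendre (h : IsAdmissible f φ M) : Continuous (legendre f) :=
  (continuous_id.mul h.continuous_deriv).sub h.differentiable.continuous

theorem intervalIntegrable (h : IsAdmissible f φ M) (a b : ℝ) :
    IntervalIntegrable φ volume a b :=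
  ((h.memLp.locallyIntegrable le_top).integrableOn_isCompact isCompact_uIcc).intervalIntegrable

theorem abs_prim_sub_le (h : IsAdmissible f φ M) (y z : ℝ) :
    |prim φ y - prim φ z| ≤ M * |y - z| := by
  unfold prim
  rw [intervalIntegral.integral_interval_sub_left (h.intervalIntegrable _ _)
    (h.intervalIntegrable _ _)]
  rw [← Real.norm_eq_abs]
  refine intervalIntegral.norm_integral_le_of_norm_le_const_ae ?_
  filter_upwards [h.bound] with x hx _ using hx

theorem continuous_prim (h : IsAdmissible f φ M) : Continuous (prim φ) :=
  intervalIntegral.continuous_primitive h.intervalIntegrable 0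

theorem continuous_action (h : IsAdmissible f φ M) :
    Continuous fun q : ℝ × ℝ × ℝ => action f φ q.1 q.2.1 q.2.2 := by
  unfold action
  have h1 := h.continuous_prim
  have h2 := h.continuous_deriv
  have h3 := h.continuous_legendre
  fun_prop

theorem intervalIntegrable_integrand (h : IsAdmissible f φ M) (x : ℝ) {t : ℝ} (ht : 0 < t)
    (w : ℝ) : IntervalIntegrable
      (fun s => deriv (deriv f) s * (φ (x - t * deriv f s) - s)) volume 0 w ∧
    ∫ s in (0 : ℝ)..w, deriv (deriv f) s * (φ (x - t * deriv f s) - s) =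
      -t⁻¹ * (prim φ (x - t * deriv f w) - prim φ (x - t * deriv f 0))
        - (legendre f w - legendre f 0) := by
  -- the substitution `y = x - t f'(s)`, which is antitone in `s`
  have hp : ∀ s, HasDerivAt (fun s => x - t * deriv f s) (-(t * deriv (deriv f) s)) s :=
    fun s => ((h.hasDerivAt_deriv s).const_mul t).const_sub x
  have hpc : Continuous fun s => x - t * deriv f s := by
    have := h.continuous_deriv
    fun_prop
  have hneg : ∀ s, -(t * deriv (deriv f) s) ≤ 0 := fun s => by
    have : 0 ≤ deriv (deriv f) s := h.strictMono.monotone.deriv_nonneg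
    have := mul_nonneg ht.le this
    linarith
  have hI := (intervalIntegral.integrable_deriv_smul_comp_iff_of_deriv_nonpos (g := φ) (a := 0)
    (b := w) hpc.continuousOn (fun s _ => hp s) fun s _ => hneg s).2 (h.intervalIntegrable _ _)
  have hE := intervalIntegral.integral_deriv_smul_comp_of_deriv_nonpos (g := φ) (a := 0)
    (b := w) hpc.continuousOn (fun s _ => hp s) fun s _ => hneg s
  have hI' : IntervalIntegrable (fun s => deriv (deriv f) s * s) volume 0 w :=
    (h.continuous_deriv_deriv.mul continuous_id).intervalIntegrable _ _
  have hℓ : ∀ s, HasDerivAt (legendre f) (deriv (deriv f) s * s) s := fun s => by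
    convert! ((hasDerivAt_id s).mul (h.hasDerivAt_deriv s)).sub
      (h.differentiable s).hasDerivAt using 1
    simp only [id]
    ring
  have hE' := intervalIntegral.integral_eq_sub_of_hasDerivAt (fun s _ => hℓ s) hI'
  have hfun : (fun s => deriv (deriv f) s * (φ (x - t * deriv f s) - s)) = fun s =>
      -t⁻¹ * (-(t * deriv (deriv f) s) • (φ ∘ fun s => x - t * deriv f s) s)
        - deriv (deriv f) s * s := by
    funext s
    simp only [Function.comp, smul_eq_mul]
    field_simp
  rw [hfun]
  refine ⟨(hI.const_mul _).sub hI', ?_⟩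
  rw [intervalIntegral.integral_sub (hI.const_mul _) hI', intervalIntegral.integral_const_mul, hE,
    hE']
  unfold prim
  rw [intervalIntegral.integral_interval_sub_left (h.intervalIntegrable _ _)
    (h.intervalIntegrable _ _)]

/-- Up to a constant, `E` is the negative of the action. -/
theorem E_eq (h : IsAdmissible f φ M) (x : ℝ) {t : ℝ} (ht : 0 < t) (w : ℝ) :
    E f φ w x t = action f φ 0 x t - action f φ w x t := by
  unfold E action
  rw [(h.intervalIntegrable_integrand x ht w).2]
  field_simp
  ring

theorem mem_maximizers (h : IsAdmissible f φ M) {x t w : ℝ} (ht : 0 < t) :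
    w ∈ maximizers f φ x t ↔ ∀ v, action f φ w x t ≤ action f φ v x t := by
  simp only [maximizers, h.E_eq x ht, mem_ofPred_eq, sub_le_sub_iff_left]

theorem action_lt_of_lt (h : IsAdmissible f φ M) (x : ℝ) {t w : ℝ} (ht : 0 < t) (hw : M < w) :
    action f φ M x t < action f φ w x t := by
  have h1 := h.abs_prim_sub_le (x - t * deriv f M) (x - t * deriv f w)
  have h2 := mul_sub_lt_legendre_sub h.differentiable h.strictMono hw.ne
  have h3 := h.strictMono hw
  have h4 : x - t * deriv f M - (x - t * deriv f w) = t * (deriv f w - deriv f M) := by ring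
  rw [h4, abs_of_nonneg (mul_nonneg ht.le (by linarith))] at h1
  have h5 := mul_lt_mul_of_pos_left h2 ht
  have h6 := (abs_le.1 h1).2
  unfold action
  linarith

theorem action_lt_of_lt_neg (h : IsAdmissible f φ M) (x : ℝ) {t w : ℝ} (ht : 0 < t)
    (hw : w < -M) : action f φ (-M) x t < action f φ w x t := by
  have h1 := h.abs_prim_sub_le (x - t * deriv f (-M)) (x - t * deriv f w)
  have h2 := mul_sub_lt_legendre_sub h.differentiable h.strictMono hw.ne'
  have h3 := h.strictMono hw
  have h4 : x - t * deriv f (-M) - (x - t * deriv f w) = -(t * (deriv f (-M) - deriv f w)) := by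
    ring
  rw [h4, abs_neg, abs_of_nonneg (mul_nonneg ht.le (by linarith))] at h1
  have h5 := mul_lt_mul_of_pos_left h2 ht
  have h6 := (abs_le.1 h1).2
  unfold action
  linarith

theorem maximizers_subset (h : IsAdmissible f φ M) (x : ℝ) {t : ℝ} (ht : 0 < t) :
    maximizers f φ x t ⊆ Icc (-M) M := by
  intro w hw
  rw [h.mem_maximizers ht] at hw
  constructor
  · by_contra! hlt
    exact (hw (-M)).not_gt (h.action_lt_of_lt_neg x ht hlt)
  · by_contra! hlt
    exact (hw M).not_gt (h.action_lt_of_lt x ht hlt)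

theorem continuous_action_left (h : IsAdmissible f φ M) (x t : ℝ) :
    Continuous fun w => action f φ w x t :=
  h.continuous_action.comp (by fun_prop : Continuous fun w : ℝ => (w, x, t))

theorem maximizers_nonempty (h : IsAdmissible f φ M) (x : ℝ) {t : ℝ} (ht : 0 < t) :
    (maximizers f φ x t).Nonempty := by
  have hM := h.nonneg
  obtain ⟨w, hw, hmin⟩ := isCompact_Icc.exists_isMinOn
    (nonempty_Icc.2 (by linarith : -M ≤ M)) (h.continuous_action_left x t).continuousOn
  refine ⟨w, (h.mem_maximizers ht).2 fun v => ?_⟩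
  rcases lt_or_ge M v with hv | hv
  · exact (hmin (right_mem_Icc.2 (by linarith))).trans (h.action_lt_of_lt x ht hv).le
  rcases lt_or_ge v (-M) with hv' | hv'
  · exact (hmin (left_mem_Icc.2 (by linarith))).trans (h.action_lt_of_lt_neg x ht hv').le
  · exact hmin ⟨hv', hv⟩

theorem isCompact_maximizers (h : IsAdmissible f φ M) (x : ℝ) {t : ℝ} (ht : 0 < t) :
    IsCompact (maximizers f φ x t) := by
  refine isCompact_Icc.of_isClosed_subset ?_ (h.maximizers_subset x ht)
  have : maximizers f φ x t = ⋂ v, {w | action f φ w x t ≤ action f φ v x t} := by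
    ext w
    simp [h.mem_maximizers ht]
  rw [this]
  exact isClosed_iInter fun v =>
    isClosed_le (h.continuous_action_left x t) continuous_const

theorem uPlus_mem (h : IsAdmissible f φ M) (x : ℝ) {t : ℝ} (ht : 0 < t) :
    uPlus f φ x t ∈ maximizers f φ x t :=
  (h.isCompact_maximizers x ht).sInf_mem (h.maximizers_nonempty x ht)

theorem uMinus_mem (h : IsAdmissible f φ M) (x : ℝ) {t : ℝ} (ht : 0 < t) :
    uMinus f φ x t ∈ maximizers f φ x t :=
  (h.isCompact_maximizers x ht).sSup_mem (h.maximizers_nonempty x ht)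

theorem uPlus_le (h : IsAdmissible f φ M) {x t w : ℝ} (ht : 0 < t)
    (hw : w ∈ maximizers f φ x t) : uPlus f φ x t ≤ w :=
  csInf_le (h.isCompact_maximizers x ht).bddBelow hw

theorem le_uMinus (h : IsAdmissible f φ M) {x t w : ℝ} (ht : 0 < t)
    (hw : w ∈ maximizers f φ x t) : w ≤ uMinus f φ x t :=
  le_csSup (h.isCompact_maximizers x ht).bddAbove hw

theorem abs_uPlus_le (h : IsAdmissible f φ M) (x : ℝ) {t : ℝ} (ht : 0 < t) :
    |uPlus f φ x t| ≤ M :=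
  abs_le.2 (h.maximizers_subset x ht (h.uPlus_mem x ht))

end IsAdmissible

/-! ### Ordering of characteristics, traces and jumps -/

theorem locallyBoundedVariationOn_sub {g k : ℝ → ℝ} {s : Set ℝ}
    (hg : LocallyBoundedVariationOn g s) (hk : LocallyBoundedVariationOn k s) :
    LocallyBoundedVariationOn (fun x => g x - k x) s := by
  intro a b ha hb
  refine ne_top_of_le_ne_top (ENNReal.add_ne_top.2 ⟨hg a b ha hb, hk a b ha hb⟩)
    (iSup_le fun p => ?_)
  refine le_trans (Finset.sum_le_sum fun i _ => ?_) (Finset.sum_add_distrib.le.trans (add_le_add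
    (eVariationOn.sum_le (f := g) p.2.2.1 fun i => p.2.2.2 i)
    (eVariationOn.sum_le (f := k) p.2.2.1 fun i => p.2.2.2 i)))
  simp only [sub_eq_add_neg]
  exact (edist_add_add_le _ _ _ _).trans (by rw [edist_neg_neg])

namespace IsAdmissible

variable {f φ : ℝ → ℝ} {M : ℝ}

/-- Backward characteristics issuing from maximizers do not cross. If they did, exchanging their
feet would lower the sum of the two actions, because the Legendre transform is strictly convex. -/
theorem foot_le_foot (h : IsAdmissible f φ M) {x₁ x₂ t w₁ w₂ : ℝ} (ht : 0 < t) (hx : x₁ < x₂)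
    (h₁ : w₁ ∈ maximizers f φ x₁ t) (h₂ : w₂ ∈ maximizers f φ x₂ t) :
    x₁ - t * deriv f w₁ ≤ x₂ - t * deriv f w₂ := by
  by_contra! hlt
  rw [h.mem_maximizers ht] at h₁ h₂
  have hcont := h.continuous_deriv
  have ha : deriv f w₁ < deriv f w₂ := by
    by_contra! hle
    have := mul_le_mul_of_nonneg_left hle ht.le
    linarith
  have hw : w₁ < w₂ := h.strictMono.lt_iff_lt.1 ha
  -- `v` joins the foot of the second characteristic to `x₁`, and `v'` the first foot to `x₂`
  obtain ⟨v, -, hv⟩ : (x₁ - (x₂ - t * deriv f w₂)) / t ∈ deriv f '' Icc w₁ w₂ := by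
    apply intermediate_value_Icc hw.le hcont.continuousOn
    constructor
    · rw [le_div_iff₀ ht]; linarith
    · rw [div_le_iff₀ ht]; linarith
  obtain ⟨v', -, hv'⟩ : (x₂ - (x₁ - t * deriv f w₁)) / t ∈ deriv f '' Icc w₁ w₂ := by
    apply intermediate_value_Icc hw.le hcont.continuousOn
    constructor
    · rw [le_div_iff₀ ht]; linarith
    · rw [div_le_iff₀ ht]; linarith
  rw [eq_div_iff ht.ne'] at hv hv'
  have e₁ := h₁ v
  have e₂ := h₂ v'
  unfold action at e₁ e₂
  rw [show x₁ - t * deriv f v = x₂ - t * deriv f w₂ by linarith] at e₁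
  rw [show x₂ - t * deriv f v' = x₁ - t * deriv f w₁ by linarith] at e₂
  have hsum : legendre f w₁ + legendre f w₂ ≤ legendre f v + legendre f v' := by
    by_contra! hlt'
    have := mul_lt_mul_of_pos_left hlt' ht
    linarith
  have hd : deriv f v + deriv f v' = deriv f w₁ + deriv f w₂ := by
    have : t * (deriv f v + deriv f v') = t * (deriv f w₁ + deriv f w₂) := by linarith
    exact mul_left_cancel₀ ht.ne' this
  have hv2 : deriv f v < deriv f w₂ := by
    by_contra! hle
    have := mul_le_mul_of_nonneg_left hle ht.le
    linarith
  have hv2' : deriv f v' < deriv f w₂ := by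
    by_contra! hle
    have := mul_le_mul_of_nonneg_left hle ht.le
    linarith
  have hne : v ≠ w₂ := fun he => by simp [he] at hv2
  have hne' : v' ≠ w₂ := fun he => by simp [he] at hv2'
  rcases le_total v' v with hvv | hvv
  · have l₁ := mul_sub_lt_legendre_sub h.differentiable h.strictMono hne
    have l₂ := mul_sub_le_legendre_sub h.differentiable h.strictMono v' w₁
    have : deriv f w₁ - deriv f v' = -(deriv f w₂ - deriv f v) := by linarith
    rw [this] at l₂
    have := mul_le_mul_of_nonneg_right hvv (sub_nonneg.2 hv2.le)
    linarith
  · have l₁ := mul_sub_lt_legendre_sub h.differentiable h.strictMono hne'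
    have l₂ := mul_sub_le_legendre_sub h.differentiable h.strictMono v w₁
    have : deriv f w₁ - deriv f v = -(deriv f w₂ - deriv f v') := by linarith
    rw [this] at l₂
    have := mul_le_mul_of_nonneg_right hvv (sub_nonneg.2 hv2'.le)
    linarith

theorem monotone_foot (h : IsAdmissible f φ M) {t : ℝ} (ht : 0 < t) :
    Monotone fun x => x - t * deriv f (uPlus f φ x t) :=
  monotone_iff_forall_lt.2 fun x _ hxy =>
    h.foot_le_foot ht hxy (h.uPlus_mem x ht) (h.uPlus_mem _ ht)

theorem oleinik_uPlus (h : IsAdmissible f φ M) {x₁ x₂ t : ℝ} (hx : x₁ < x₂) (ht : 0 < t) :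
    deriv f (uPlus f φ x₂ t) - deriv f (uPlus f φ x₁ t) ≤ (x₂ - x₁) / t := by
  have := h.monotone_foot ht hx.le
  simp only at this
  rw [le_div_iff₀ ht]
  linarith

/-- Limits of maximizers are maximizers. -/
theorem mem_maximizers_of_mapClusterPt (h : IsAdmissible f φ M) {x t w : ℝ} (ht : 0 < t)
    {l : Filter ℝ} (hl : l ≤ 𝓝 x) (hw : MapClusterPt w l fun y => uPlus f φ y t) :
    w ∈ maximizers f φ x t := by
  rw [h.mem_maximizers ht]
  intro v
  obtain ⟨U, hU, hUw⟩ := mapClusterPt_iff_ultrafilter.1 hw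
  have hUx : Tendsto (fun y : ℝ => y) U (𝓝 x) := hU.trans hl
  have hg1 : Tendsto (fun y => (uPlus f φ y t, y, t)) U (𝓝 (w, x, t)) :=
    hUw.prodMk_nhds (hUx.prodMk_nhds tendsto_const_nhds)
  have hg2 : Tendsto (fun y => (v, y, t)) U (𝓝 (v, x, t)) :=
    tendsto_const_nhds.prodMk_nhds (hUx.prodMk_nhds tendsto_const_nhds)
  have h1 := (h.continuous_action.tendsto _).comp hg1
  have h2 := (h.continuous_action.tendsto _).comp hg2
  exact le_of_tendsto_of_tendsto' h1 h2 fun y =>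
    (h.mem_maximizers ht).1 (h.uPlus_mem y ht) v

theorem tendsto_uPlus_left (h : IsAdmissible f φ M) (x : ℝ) {t : ℝ} (ht : 0 < t) :
    Tendsto (fun y => uPlus f φ y t) (𝓝[<] x) (𝓝 (uMinus f φ x t)) := by
  refine isCompact_Icc.tendsto_nhds_of_unique_mapClusterPt
    (Eventually.of_forall fun y => h.maximizers_subset y ht (h.uPlus_mem y ht)) ?_
  intro w _ hw
  refine le_antisymm
    (h.le_uMinus ht (h.mem_maximizers_of_mapClusterPt ht nhdsWithin_le_nhds hw)) ?_
  obtain ⟨U, hU, hUw⟩ := mapClusterPt_iff_ultrafilter.1 hw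
  have hUx : Tendsto (fun y : ℝ => y) U (𝓝 x) := hU.trans nhdsWithin_le_nhds
  have h1 : Tendsto (fun y => y - t * deriv f (uPlus f φ y t)) U (𝓝 (x - t * deriv f w)) :=
    hUx.sub (((h.continuous_deriv.tendsto w).comp hUw).const_mul t)
  have h2 : x - t * deriv f w ≤ x - t * deriv f (uMinus f φ x t) :=
    le_of_tendsto h1 ((eventually_mem_nhdsWithin.filter_mono hU).mono fun y hy =>
      h.foot_le_foot ht hy (h.uPlus_mem y ht) (h.uMinus_mem x ht))
  exact h.strictMono.le_iff_le.1 (le_of_mul_le_mul_left (by linarith) ht)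

theorem tendsto_uPlus_right (h : IsAdmissible f φ M) (x : ℝ) {t : ℝ} (ht : 0 < t) :
    Tendsto (fun y => uPlus f φ y t) (𝓝[>] x) (𝓝 (uPlus f φ x t)) := by
  refine isCompact_Icc.tendsto_nhds_of_unique_mapClusterPt
    (Eventually.of_forall fun y => h.maximizers_subset y ht (h.uPlus_mem y ht)) ?_
  intro w _ hw
  refine le_antisymm ?_ (h.uPlus_le ht (h.mem_maximizers_of_mapClusterPt ht nhdsWithin_le_nhds hw))
  obtain ⟨U, hU, hUw⟩ := mapClusterPt_iff_ultrafilter.1 hw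
  have hUx : Tendsto (fun y : ℝ => y) U (𝓝 x) := hU.trans nhdsWithin_le_nhds
  have h1 : Tendsto (fun y => y - t * deriv f (uPlus f φ y t)) U (𝓝 (x - t * deriv f w)) :=
    hUx.sub (((h.continuous_deriv.tendsto w).comp hUw).const_mul t)
  have h2 : x - t * deriv f (uPlus f φ x t) ≤ x - t * deriv f w :=
    ge_of_tendsto h1 ((eventually_mem_nhdsWithin.filter_mono hU).mono fun y hy =>
      h.foot_le_foot ht hy (h.uPlus_mem x ht) (h.uPlus_mem y ht))
  exact h.strictMono.le_iff_le.1 (le_of_mul_le_mul_left (by linarith) ht)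

theorem continuousAt_uPlus (h : IsAdmissible f φ M) {x t : ℝ} (ht : 0 < t)
    (he : uMinus f φ x t = uPlus f φ x t) : ContinuousAt (fun y => uPlus f φ y t) x :=
  continuousAt_iff_continuous_left'_right'.2
    ⟨by simpa only [ContinuousWithinAt, ← he] using h.tendsto_uPlus_left x ht,
      h.tendsto_uPlus_right x ht⟩

theorem countable_jumps (h : IsAdmissible f φ M) {t : ℝ} (ht : 0 < t) :
    {x | uPlus f φ x t < uMinus f φ x t}.Countable := by
  refine (h.monotone_foot ht).countable_not_continuousAt.mono ?_
  intro x hx hc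
  have h1 : Tendsto (fun y => y - t * deriv f (uPlus f φ y t)) (𝓝[<] x)
      (𝓝 (x - t * deriv f (uMinus f φ x t))) :=
    (tendsto_id.mono_left nhdsWithin_le_nhds).sub
      (((h.continuous_deriv.tendsto _).comp (h.tendsto_uPlus_left x ht)).const_mul t)
  have h2 := tendsto_nhds_unique h1 (hc.tendsto.mono_left nhdsWithin_le_nhds)
  have h3 := mul_lt_mul_of_pos_left (h.strictMono hx) ht
  linarith

theorem exists_jumps (h : IsAdmissible f φ M) {t : ℝ} (ht : 0 < t) : ∃ S : Set ℝ, S.Countable ∧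
    (∀ x : ℝ, x ∉ S → uMinus f φ x t = uPlus f φ x t ∧
      ContinuousAt (fun y => uPlus f φ y t) x) ∧
    ∀ x ∈ S, uPlus f φ x t < uMinus f φ x t := by
  refine ⟨_, h.countable_jumps ht, fun x hx => ?_, fun x hx => hx⟩
  have he : uMinus f φ x t = uPlus f φ x t :=
    le_antisymm (not_lt.1 hx) (h.uPlus_le ht (h.uMinus_mem x ht))
  exact ⟨he, h.continuousAt_uPlus ht he⟩

theorem locallyBoundedVariationOn_deriv_uPlus (h : IsAdmissible f φ M) {t : ℝ} (ht : 0 < t) :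
    LocallyBoundedVariationOn (fun x => deriv f (uPlus f φ x t)) univ := by
  have h1 : Monotone fun x : ℝ => t⁻¹ * x := monotone_id.const_mul (inv_nonneg.2 ht.le)
  have h2 : Monotone fun x : ℝ => t⁻¹ * (x - t * deriv f (uPlus f φ x t)) :=
    (h.monotone_foot ht).const_mul (inv_nonneg.2 ht.le)
  convert locallyBoundedVariationOn_sub (h1.monotoneOn univ).locallyBoundedVariationOn
    (h2.monotoneOn univ).locallyBoundedVariationOn using 1
  funext x
  field_simp
  ring

end IsAdmissible

/-! ### The value function of the Lax–Oleinik problem -/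

/-- The minimal action over `[-M, M]`. For positive times this is the minimum over all of `ℝ`; the
bounded range of `w` makes the function globally Lipschitz on the plane, and the initial condition
`value (x, 0) = prim φ x` holds as well. -/
noncomputable def value (f φ : ℝ → ℝ) (M : ℝ) (p : ℝ × ℝ) : ℝ :=
  sInf ((fun w => action f φ w p.1 p.2) '' Icc (-M) M)

namespace IsAdmissible

variable {f φ : ℝ → ℝ} {M : ℝ}

theorem isCompact_image_action (h : IsAdmissible f φ M) (p : ℝ × ℝ) :
    IsCompact ((fun w => action f φ w p.1 p.2) '' Icc (-M) M) :=
  isCompact_Icc.image (h.continuous_action_left p.1 p.2)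

theorem value_le_of_mem (h : IsAdmissible f φ M) (p : ℝ × ℝ) {w : ℝ} (hw : w ∈ Icc (-M) M) :
    value f φ M p ≤ action f φ w p.1 p.2 :=
  csInf_le (h.isCompact_image_action p).bddBelow (mem_image_of_mem _ hw)

theorem exists_value_eq (h : IsAdmissible f φ M) (p : ℝ × ℝ) :
    ∃ w ∈ Icc (-M) M, action f φ w p.1 p.2 = value f φ M p :=
  (h.isCompact_image_action p).sInf_mem
    ((nonempty_Icc.2 (neg_le_self h.nonneg)).image _)

theorem value_eq (h : IsAdmissible f φ M) {x t w : ℝ} (ht : 0 < t)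
    (hw : w ∈ maximizers f φ x t) : value f φ M (x, t) = action f φ w x t := by
  obtain ⟨v, -, hv⟩ := h.exists_value_eq (x, t)
  exact le_antisymm (h.value_le_of_mem _ (h.maximizers_subset x ht hw))
    (hv ▸ (h.mem_maximizers ht).1 hw v)

theorem value_le (h : IsAdmissible f φ M) (x : ℝ) {t : ℝ} (ht : 0 < t) (w : ℝ) :
    value f φ M (x, t) ≤ action f φ w x t := by
  rw [h.value_eq ht (h.uPlus_mem x ht)]
  exact (h.mem_maximizers ht).1 (h.uPlus_mem x ht) w

theorem value_zero (h : IsAdmissible f φ M) (x : ℝ) : value f φ M (x, 0) = prim φ x := by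
  obtain ⟨w, -, hw⟩ := h.exists_value_eq (x, 0)
  rw [← hw]
  simp [action]

theorem exists_lipschitzWith_value (h : IsAdmissible f φ M) :
    ∃ K, LipschitzWith K (value f φ M) := by
  obtain ⟨A, hA⟩ := isCompact_Icc.exists_bound_of_continuousOn (s := Icc (-M) M)
    h.continuous_deriv.continuousOn
  obtain ⟨B, hB⟩ := isCompact_Icc.exists_bound_of_continuousOn (s := Icc (-M) M)
    h.continuous_legendre.continuousOn
  refine ⟨_, LipschitzWith.of_le_add_mul' (M * (1 + A) + B) fun p q => ?_⟩
  obtain ⟨w, hw, hq⟩ := h.exists_value_eq q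
  refine (h.value_le_of_mem p hw).trans ?_
  rw [← hq]
  have hx : |p.1 - q.1| ≤ dist p q := by
    rw [← Real.dist_eq]; exact le_max_left _ _
  have ht : |p.2 - q.2| ≤ dist p q := by
    rw [← Real.dist_eq]; exact le_max_right _ _
  have hd : 0 ≤ dist p q := dist_nonneg
  have hA' := hA w hw
  have hB' := hB w hw
  rw [Real.norm_eq_abs] at hA' hB'
  have hA0 := (abs_nonneg _).trans hA'
  have h1 := (abs_le.1 (h.abs_prim_sub_le (p.1 - p.2 * deriv f w) (q.1 - q.2 * deriv f w))).2
  have h2 : |p.1 - p.2 * deriv f w - (q.1 - q.2 * deriv f w)| ≤ (1 + A) * dist p q := by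
    rw [show p.1 - p.2 * deriv f w - (q.1 - q.2 * deriv f w) =
      (p.1 - q.1) - (p.2 - q.2) * deriv f w by ring]
    refine (abs_sub _ _).trans ?_
    rw [abs_mul]
    have := mul_le_mul ht hA' (abs_nonneg _) hd
    linarith
  have h3 : (p.2 - q.2) * legendre f w ≤ dist p q * B :=
    (le_abs_self _).trans (by
      rw [abs_mul]
      exact mul_le_mul ht hB' (abs_nonneg _) hd)
  have h4 := mul_le_mul_of_nonneg_left h2 h.nonneg
  unfold action
  linarith

/-- Moving the endpoint of an optimal characteristic along `x + t (f'(c) - f'(w))` keeps its foot,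
which bounds the increment of the value function by `c` times the displacement. -/
theorem value_add_le (h : IsAdmissible f φ M) {x t w : ℝ} (ht : 0 < t)
    (hw : w ∈ maximizers f φ x t) (c : ℝ) :
    value f φ M (x + t * (deriv f c - deriv f w), t) - value f φ M (x, t) ≤
      c * (t * (deriv f c - deriv f w)) := by
  have h1 := h.value_le (x + t * (deriv f c - deriv f w)) ht c
  have h2 := h.value_eq ht hw
  have h3 := mul_le_mul_of_nonneg_left
    (mul_sub_le_legendre_sub h.differentiable h.strictMono c w) ht.le
  unfold action at h1 h2
  rw [show x + t * (deriv f c - deriv f w) - t * deriv f c = x - t * deriv f w by ring] at h1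
  linarith

theorem eq_of_hasDerivAt_value (h : IsAdmissible f φ M) {x t w d : ℝ} (ht : 0 < t)
    (hw : w ∈ maximizers f φ x t)
    (hd : HasDerivAt (fun y => value f φ M (y, t)) d x) : d = w := by
  have hγ : Continuous fun c => x + t * (deriv f c - deriv f w) := by
    have := h.continuous_deriv
    fun_prop
  have hγw : Tendsto (fun c => x + t * (deriv f c - deriv f w)) (𝓝[≠] w) (𝓝[≠] x) := by
    refine tendsto_nhdsWithin_iff.2 ⟨?_, ?_⟩
    · have := hγ.tendsto w
      simp only [sub_self, mul_zero, add_zero] at this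
      exact this.mono_left nhdsWithin_le_nhds
    · filter_upwards [self_mem_nhdsWithin] with c (hc : c ≠ w)
      have : deriv f c - deriv f w ≠ 0 := sub_ne_zero.2 fun e => hc (h.strictMono.injective e)
      simp [ht.ne', this]
  have hs := (hasDerivAt_iff_tendsto_slope.1 hd).comp hγw
  have hslope : ∀ c, slope (fun y => value f φ M (y, t)) x (x + t * (deriv f c - deriv f w)) =
      (value f φ M (x + t * (deriv f c - deriv f w), t) - value f φ M (x, t)) /
        (t * (deriv f c - deriv f w)) := fun c => by
    rw [slope_def_field]
    simp
  refine le_antisymm ?_ ?_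
  · refine le_of_tendsto_of_tendsto
      (hs.mono_left (nhdsWithin_mono w (s := Ioi w) fun c hc => ne_of_gt hc))
      (tendsto_id.mono_left (nhdsWithin_le_nhds (s := Ioi w))) ?_
    filter_upwards [self_mem_nhdsWithin] with c (hc : w < c)
    have : 0 < t * (deriv f c - deriv f w) := mul_pos ht (sub_pos.2 (h.strictMono hc))
    simp only [Function.comp, hslope, id]
    rw [div_le_iff₀ this]
    exact h.value_add_le ht hw c
  · refine le_of_tendsto_of_tendsto (tendsto_id.mono_left (nhdsWithin_le_nhds (s := Iio w)))
      (hs.mono_left (nhdsWithin_mono w (s := Iio w) fun c hc => ne_of_lt hc)) ?_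
    filter_upwards [self_mem_nhdsWithin] with c (hc : c < w)
    have : t * (deriv f c - deriv f w) < 0 :=
      mul_neg_of_pos_of_neg ht (sub_neg.2 (h.strictMono hc))
    simp only [Function.comp, hslope, id]
    rw [le_div_iff_of_neg this]
    exact h.value_add_le ht hw c

theorem fderiv_value (h : IsAdmissible f φ M) {x t w : ℝ} (ht : 0 < t)
    (hw : w ∈ maximizers f φ x t) {L : ℝ × ℝ →L[ℝ] ℝ}
    (hL : HasFDerivAt (value f φ M) L (x, t)) : L (1, 0) = w ∧ L (0, 1) = -f w := by
  have h1 : L (1, 0) = w := by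
    refine h.eq_of_hasDerivAt_value ht hw ?_
    exact hL.comp_hasDerivAt x ((hasDerivAt_id x).prodMk (hasDerivAt_const x t))
  -- along the characteristic line the value function is touched from above by an affine function
  have h2 : HasDerivAt (fun s => value f φ M (x + s * deriv f w, t + s) - s * legendre f w)
      (L (deriv f w, 1) - legendre f w) 0 := by
    have hγ : HasDerivAt (fun s : ℝ => (x + s * deriv f w, t + s)) (deriv f w, 1) 0 := by
      simpa using! (((hasDerivAt_id (0 : ℝ)).mul_const (deriv f w)).const_add x).prodMk
        ((hasDerivAt_id (0 : ℝ)).const_add t)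
    have hL' : HasFDerivAt (value f φ M) L (x + 0 * deriv f w, t + 0) := by simpa using! hL
    simpa using! (hL'.comp_hasDerivAt (0 : ℝ) hγ).sub
      ((hasDerivAt_id (0 : ℝ)).mul_const (legendre f w))
  have h3 : IsLocalMax (fun s => value f φ M (x + s * deriv f w, t + s) - s * legendre f w) 0 := by
    filter_upwards [Ioi_mem_nhds (neg_neg_of_pos ht)] with s (hs : -t < s)
    have e1 := h.value_le (x + s * deriv f w) (by linarith : 0 < t + s) w
    have e2 := h.value_eq ht hw
    unfold action at e1 e2
    rw [show x + s * deriv f w - (t + s) * deriv f w = x - t * deriv f w by ring] at e1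
    simp only [zero_mul, add_zero, sub_zero, e2]
    linarith
  have h4 := h3.hasDerivAt_eq_zero h2
  have h5 : L (deriv f w, 1) = deriv f w * L (1, 0) + L (0, 1) := by
    rw [← smul_eq_mul, ← map_smul, ← map_add]
    simp
  rw [h5, h1] at h4
  unfold legendre at h4
  exact ⟨h1, by linarith⟩

theorem ae_lineDeriv_value (h : IsAdmissible f φ M) :
    ∀ᵐ p : ℝ × ℝ, 0 < p.2 → lineDeriv ℝ (value f φ M) p (1, 0) = uPlus f φ p.1 p.2 ∧
      lineDeriv ℝ (value f φ M) p (0, 1) = -f (uPlus f φ p.1 p.2) := by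
  obtain ⟨K, hK⟩ := h.exists_lipschitzWith_value
  filter_upwards [hK.ae_differentiableAt] with p hp ht
  rw [hp.lineDeriv_eq_fderiv, hp.lineDeriv_eq_fderiv]
  exact h.fderiv_value ht (h.uPlus_mem p.1 ht) hp.hasFDerivAt

end IsAdmissible

/-! ### Existence: Lipschitz potentials and the weak equation -/

theorem measurableSet_upperHalf : MeasurableSet upperHalf :=
  measurableSet_lt measurable_const measurable_snd

theorem isOpen_upperHalf : IsOpen upperHalf :=
  isOpen_lt continuous_const continuous_snd

/-- Mixed second derivatives of a test function commute, so a Lipschitz potential solves the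
conservation law in the sense of distributions. -/
theorem integral_lineDeriv_curl {V : ℝ × ℝ → ℝ} {K : NNReal} (hV : LipschitzWith K V)
    {ψ : ℝ × ℝ → ℝ} (hψ : ContDiff ℝ (⊤ : ℕ∞) ψ) (hc : HasCompactSupport ψ) :
    ∫ p, (lineDeriv ℝ V p (1, 0) * fderiv ℝ ψ p (0, 1) -
      lineDeriv ℝ V p (0, 1) * fderiv ℝ ψ p (1, 0)) = 0 := by
  have hψ2 : ContDiff ℝ 2 ψ := hψ.of_le (WithTop.coe_le_coe.2 (le_top : (2 : ℕ∞) ≤ ⊤))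
  have hψ' : ContDiff ℝ 1 (fderiv ℝ ψ) := hψ2.fderiv_right one_add_one_eq_two.le
  have hd : ∀ v : ℝ × ℝ, ContDiff ℝ 1 fun p => fderiv ℝ ψ p v := fun v =>
    hψ'.clm_apply contDiff_const
  have hdc : ∀ v : ℝ × ℝ, HasCompactSupport fun p => fderiv ℝ ψ p v := fun v =>
    hc.fderiv_apply ℝ v
  have hdl : ∀ v : ℝ × ℝ, ∃ D, LipschitzWith D fun p => fderiv ℝ ψ p v := fun v =>
    (hd v).lipschitzWith_of_hasCompactSupport (hdc v) one_ne_zero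
  have hI : ∀ v w : ℝ × ℝ, Integrable fun p => lineDeriv ℝ V p v * fderiv ℝ ψ p w := fun v w =>
    ((hd w).continuous.integrable_of_hasCompactSupport (hdc w)).bdd_mul (c := K * ‖v‖)
      (hV.memLp_lineDeriv (μ := volume) v).aestronglyMeasurable
      (Eventually.of_forall fun p => norm_lineDeriv_le_of_lipschitz ℝ hV)
  have e : ∀ v w p, lineDeriv ℝ (fun p => fderiv ℝ ψ p v) p w =
      fderiv ℝ (fun p => fderiv ℝ ψ p v) p w := fun v w p =>
    ((hd v).differentiable one_ne_zero p).lineDeriv_eq_fderiv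
  have hI' : ∀ v w, Integrable fun p => lineDeriv ℝ (fun p => fderiv ℝ ψ p v) p w * V p := by
    intro v w
    simp only [e]
    refine Continuous.integrable_of_hasCompactSupport ?_ ?_
    · exact (((hd v).continuous_fderiv one_ne_zero).clm_apply continuous_const).mul hV.continuous
    · exact ((hdc v).fderiv_apply ℝ w).mul_right
  obtain ⟨D₁, hD₁⟩ := hdl (0, 1)
  obtain ⟨D₂, hD₂⟩ := hdl (1, 0)
  rw [integral_sub (hI _ _) (hI _ _), hV.integral_lineDeriv_mul_eq hD₁ (hdc _),
    hV.integral_lineDeriv_mul_eq hD₂ (hdc _), ← integral_sub (hI' _ _) (hI' _ _)]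
  refine integral_eq_zero_of_ae (Eventually.of_forall fun p => ?_)
  have e' : ∀ v w : ℝ × ℝ, fderiv ℝ (fun p => fderiv ℝ ψ p v) p w =
      fderiv ℝ (fderiv ℝ ψ) p w v := fun v w => by
    rw [fderiv_clm_apply (hψ'.differentiable one_ne_zero p) (differentiableAt_const _)]
    simp
  have hs : IsSymmSndFDerivAt ℝ ψ p := hψ2.contDiffAt.isSymmSndFDerivAt (by simp)
  simp only [e, e', map_neg, neg_apply, Pi.zero_apply]
  rw [hs.eq]
  ring

theorem intervalIntegrable_of_ae_deriv {g k : ℝ → ℝ} {K : NNReal} (hg : LipschitzWith K g)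
    (hk : ∀ᵐ y, HasDerivAt g (k y) y) (a b : ℝ) :
    IntervalIntegrable k volume a b ∧ ∫ y in a..b, k y = g b - g a := by
  have hac := (hg.lipschitzOnWith (s := uIcc a b)).absolutelyContinuousOnInterval
  have he : ∀ᵐ y, deriv g y = k y := by
    filter_upwards [hk] with y hy using hy.deriv
  refine ⟨hac.intervalIntegrable_deriv.congr_ae (ae_restrict_of_ae he), ?_⟩
  rw [← hac.integral_deriv_eq_sub]
  exact intervalIntegral.integral_congr_ae (he.mono fun y hy _ => hy.symm)

namespace IsAdmissible

variable {f φ : ℝ → ℝ} {M : ℝ}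

theorem integral_uPlus (h : IsAdmissible f φ M) {t : ℝ} (ht : 0 < t) (a b : ℝ) :
    IntervalIntegrable (fun x => uPlus f φ x t) volume a b ∧
      ∫ x in a..b, uPlus f φ x t = value f φ M (b, t) - value f φ M (a, t) := by
  obtain ⟨K, hK⟩ := h.exists_lipschitzWith_value
  have hKt : LipschitzWith (K * 1) fun x => value f φ M (x, t) :=
    hK.comp (LipschitzWith.prodMk_right t)
  refine intervalIntegrable_of_ae_deriv hKt ?_ a b
  filter_upwards [hKt.ae_differentiableAt] with x hx
  rw [← h.eq_of_hasDerivAt_value ht (h.uPlus_mem x ht) hx.hasDerivAt]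
  exact hx.hasDerivAt

theorem isWeakSolution_uPlus (h : IsAdmissible f φ M) : IsWeakSolution f φ (uPlus f φ) := by
  obtain ⟨K, hK⟩ := h.exists_lipschitzWith_value
  have hae := h.ae_lineDeriv_value
  refine ⟨⟨M, fun x t ht => h.abs_uPlus_le x ht⟩, ?_, ?_, ?_⟩
  · refine (hK.memLp_lineDeriv (μ := volume.restrict upperHalf) (1, 0)).1.aemeasurable.congr ?_
    filter_upwards [ae_restrict_of_ae hae, ae_restrict_mem measurableSet_upperHalf] with p hp hp'
    exact (hp hp').1
  · intro ψ hψ hc hsupp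
    refine Eq.trans ?_ ((setIntegral_eq_integral_of_forall_compl_eq_zero
      (s := upperHalf) ?_).trans (integral_lineDeriv_curl hK hψ hc))
    · refine setIntegral_congr_ae measurableSet_upperHalf ?_
      filter_upwards [hae] with p hp hp'
      rw [(hp hp').1, (hp hp').2]
      ring
    · intro p hp
      have : fderiv ℝ ψ p = 0 := by
        by_contra hne
        exact hp (hsupp (support_fderiv_subset ℝ hne))
      simp [this]
  · intro a b
    refine ⟨?_, ?_⟩
    · filter_upwards [self_mem_nhdsWithin] with t ht using (h.integral_uPlus ht a b).1
    have hlim : ∀ x : ℝ, Tendsto (fun t => value f φ M (x, t)) (𝓝[>] 0) (𝓝 (prim φ x)) := by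
      intro x
      rw [← h.value_zero x]
      exact ((hK.continuous.comp (Continuous.prodMk_right x)).tendsto 0).mono_left
        nhdsWithin_le_nhds
    have := (hlim b).sub (hlim a)
    rw [show prim φ b - prim φ a = ∫ x in a..b, φ x by
      unfold prim
      rw [intervalIntegral.integral_interval_sub_left (h.intervalIntegrable _ _)
        (h.intervalIntegrable _ _)]] at this
    refine this.congr' ?_
    filter_upwards [self_mem_nhdsWithin] with t ht using (h.integral_uPlus ht a b).2.symm

theorem isEntropySolution_uPlus (h : IsAdmissible f φ M) : IsEntropySolution f φ (uPlus f φ) :=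
  ⟨h.isWeakSolution_uPlus, fun _ _ _ hx ht => h.oleinik_uPlus hx ht⟩

end IsAdmissible

/-! ### Potentials of curl-free bounded fields -/

/-- The mollification of `g` by the normalized bump `β`. -/
noncomputable def mollify (β : ContDiffBump (0 : ℝ × ℝ)) (g : ℝ × ℝ → ℝ) : ℝ × ℝ → ℝ :=
  convolution (β.normed volume) g (ContinuousLinearMap.lsmul ℝ ℝ) volume

theorem mollify_apply (β : ContDiffBump (0 : ℝ × ℝ)) (g : ℝ × ℝ → ℝ) (p : ℝ × ℝ) :
    mollify β g p = ∫ q, β.normed volume (p - q) * g q :=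
  convolution_lsmul_swap

theorem contDiff_mollify (β : ContDiffBump (0 : ℝ × ℝ)) {g : ℝ × ℝ → ℝ}
    (hg : LocallyIntegrable g) : ContDiff ℝ 1 (mollify β g) :=
  β.hasCompactSupport_normed.contDiff_convolution_left (n := 1) _ β.contDiff_normed hg

theorem fderiv_mollify (β : ContDiffBump (0 : ℝ × ℝ)) {g : ℝ × ℝ → ℝ}
    (hg : LocallyIntegrable g) (p d : ℝ × ℝ) :
    fderiv ℝ (mollify β g) p d = ∫ q, g q * fderiv ℝ (β.normed volume) (p - q) d := by
  have h1 : ContDiff ℝ 1 (β.normed (volume : Measure (ℝ × ℝ))) := β.contDiff_normed (n := 1)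
  have h2 := β.hasCompactSupport_normed (μ := (volume : Measure (ℝ × ℝ)))
  have h3 := h2.hasFDerivAt_convolution_right (ContinuousLinearMap.lsmul ℝ ℝ).flip hg h1 p
  rw [convolution_flip] at h3
  unfold mollify
  rw [h3.fderiv, convolution_precompR_apply _ hg (h2.fderiv ℝ) (h1.continuous_fderiv one_ne_zero)]
  simp only [convolution_def, ContinuousLinearMap.flip_apply, ContinuousLinearMap.lsmul_apply,
    smul_eq_mul, mul_comm]

theorem integrable_normed_sub_mul (β : ContDiffBump (0 : ℝ × ℝ)) {g : ℝ × ℝ → ℝ}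
    (hg : LocallyIntegrable g) (p : ℝ × ℝ) :
    Integrable fun q => β.normed volume (p - q) * g q := by
  have h2 := β.hasCompactSupport_normed (μ := (volume : Measure (ℝ × ℝ)))
  refine LocallyIntegrable.integrable_smul_left_of_hasCompactSupport (f := g)
    (g := fun q => β.normed volume (p - q)) hg ?_ ?_
  · exact β.continuous_normed.comp (continuous_const.sub continuous_id)
  · exact h2.comp_homeomorph (Homeomorph.subLeft p)

theorem mollify_le (β : ContDiffBump (0 : ℝ × ℝ)) {g : ℝ × ℝ → ℝ} (hg : LocallyIntegrable g)
    {κ : ℝ} (hκ : ∀ᵐ p, p ∈ upperHalf → g p ≤ κ) {p : ℝ × ℝ} (hp : β.rOut < p.2) :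
    mollify β g p ≤ κ := by
  have h1 : ∫ q, β.normed volume (p - q) * κ = κ := by
    rw [integral_mul_const, integral_sub_left_eq_self (β.normed volume) volume p,
      β.integral_normed, one_mul]
  rw [mollify_apply]
  refine le_trans (integral_mono_ae (integrable_normed_sub_mul β hg p)
    (integrable_normed_sub_mul β (locallyIntegrable_const κ) p) ?_) h1.le
  filter_upwards [hκ] with q hq
  by_cases hz : β.normed volume (p - q) = 0
  · simp [hz]
  · refine mul_le_mul_of_nonneg_left (hq ?_) (β.nonneg_normed _)
    have : p - q ∈ Metric.ball (0 : ℝ × ℝ) β.rOut := by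
      rw [← β.support_normed_eq (μ := volume)]; exact hz
    rw [mem_ball_zero_iff] at this
    have h2 : |p.2 - q.2| < β.rOut := (norm_snd_le (p - q)).trans_lt this
    have := (abs_lt.1 h2).2
    change 0 < q.2
    linarith

theorem abs_mollify_le (β : ContDiffBump (0 : ℝ × ℝ)) {g : ℝ × ℝ → ℝ} (hg : LocallyIntegrable g)
    {C : ℝ} (hC : ∀ p, |g p| ≤ C) {p : ℝ × ℝ} (hp : β.rOut < p.2) : |mollify β g p| ≤ C := by
  have h1 := mollify_le β hg (κ := C) (Eventually.of_forall fun q _ => (abs_le.1 (hC q)).2) hp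
  have h2 := mollify_le β hg.neg (κ := C)
    (Eventually.of_forall fun q _ => neg_le.1 (abs_le.1 (hC q)).1) hp
  have h3 : mollify β (-g) p = -mollify β g p := by
    simp [mollify_apply, integral_neg]
  rw [h3] at h2
  exact abs_le.2 ⟨by linarith, h1⟩

/-- The field `(G₁, G₂)` is curl-free in the upper half-plane in the sense of distributions. -/
def IsCurlFree (G₁ G₂ : ℝ × ℝ → ℝ) : Prop :=
  ∀ ψ : ℝ × ℝ → ℝ, ContDiff ℝ (⊤ : ℕ∞) ψ → HasCompactSupport ψ → tsupport ψ ⊆ upperHalf →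
    ∫ p, (G₁ p * fderiv ℝ ψ p (0, 1) - G₂ p * fderiv ℝ ψ p (1, 0)) = 0

theorem IsCurlFree.fderiv_mollify_eq {G₁ G₂ : ℝ × ℝ → ℝ} (h : IsCurlFree G₁ G₂)
    (h₁ : LocallyIntegrable G₁) (h₂ : LocallyIntegrable G₂) (β : ContDiffBump (0 : ℝ × ℝ))
    {p : ℝ × ℝ} (hp : β.rOut < p.2) :
    fderiv ℝ (mollify β G₁) p (0, 1) = fderiv ℝ (mollify β G₂) p (1, 0) := by
  have hc1 : ContDiff ℝ 1 (β.normed (volume : Measure (ℝ × ℝ))) := β.contDiff_normed (n := 1)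
  have hc := β.hasCompactSupport_normed (μ := (volume : Measure (ℝ × ℝ)))
  have hd : ∀ q d : ℝ × ℝ, fderiv ℝ (fun q => β.normed volume (p - q)) q d =
      -fderiv ℝ (β.normed volume) (p - q) d := fun q d => by
    have := (hc1.differentiable one_ne_zero (p - q)).hasFDerivAt.comp q
      ((hasFDerivAt_id q).const_sub p)
    have e : fderiv ℝ (fun q => β.normed volume (p - q)) q = _ := this.fderiv
    rw [e]
    simp
  have hI : ∀ (G : ℝ × ℝ → ℝ) (d : ℝ × ℝ), LocallyIntegrable G →
      Integrable fun q => G q * fderiv ℝ (β.normed volume) (p - q) d := by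
    intro G d hG
    refine LocallyIntegrable.integrable_smul_right_of_hasCompactSupport (f := G)
      (g := fun q => fderiv ℝ (β.normed volume) (p - q) d) hG ?_ ?_
    · exact ((hc1.continuous_fderiv one_ne_zero).comp
        (continuous_const.sub continuous_id)).clm_apply continuous_const
    · exact (hc.fderiv_apply ℝ d).comp_homeomorph (Homeomorph.subLeft p)
  have := h (fun q => β.normed volume (p - q))
    (β.contDiff_normed.comp (contDiff_const.sub contDiff_id))
    (hc.comp_homeomorph (Homeomorph.subLeft p)) ?_
  · simp only [hd] at this
    rw [fderiv_mollify β h₁, fderiv_mollify β h₂, ← sub_eq_zero, ← integral_sub (hI _ _ h₁)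
      (hI _ _ h₂), ← neg_eq_zero, ← integral_neg]
    refine Eq.trans (integral_congr_ae (Eventually.of_forall fun q => ?_)) this
    simp only
    ring
  · have hsub : tsupport (fun q => β.normed volume (p - q)) ⊆ Metric.closedBall p β.rOut := by
      refine closure_minimal (fun q hq => ?_) Metric.isClosed_closedBall
      have : p - q ∈ Metric.ball (0 : ℝ × ℝ) β.rOut := by
        rw [← β.support_normed_eq (μ := volume)]; exact hq
      rw [mem_ball_zero_iff, ← dist_eq_norm, dist_comm] at this
      exact this.le
    refine hsub.trans fun q hq => ?_
    have h2 : |q.2 - p.2| ≤ β.rOut := by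
      rw [← Real.dist_eq]
      exact (le_max_right _ _).trans hq
    have := (abs_le.1 h2).1
    change 0 < q.2
    linarith

theorem IsCurlFree.exists_mollified_potential {G₁ G₂ : ℝ × ℝ → ℝ} {C : ℝ}
    (h : IsCurlFree G₁ G₂) (h₁ : LocallyIntegrable G₁) (h₂ : LocallyIntegrable G₂)
    (b₁ : ∀ p, |G₁ p| ≤ C) (b₂ : ∀ p, |G₂ p| ≤ C) (β : ContDiffBump (0 : ℝ × ℝ)) :
    ∃ w : ℝ × ℝ → ℝ, LipschitzWith (2 * C).toNNReal w ∧ w (0, 1) = 0 ∧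
      ∀ p : ℝ × ℝ, β.rOut < p.2 → HasFDerivAt w
        (mollify β G₁ p • ContinuousLinearMap.fst ℝ ℝ ℝ +
          mollify β G₂ p • ContinuousLinearMap.snd ℝ ℝ ℝ) p := by
  set U : Set (ℝ × ℝ) := {p | β.rOut < p.2} with hU
  have hUo : IsOpen U := isOpen_lt continuous_const continuous_snd
  have hUc : Convex ℝ U := (convex_Ioi β.rOut).is_linear_preimage ⟨Prod.snd_add, Prod.smul_snd⟩
  have d₁ := (contDiff_mollify β h₁).differentiable one_ne_zero
  have d₂ := (contDiff_mollify β h₂).differentiable one_ne_zero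
  set ω : ℝ × ℝ → ℝ × ℝ →L[ℝ] ℝ := fun p => mollify β G₁ p • ContinuousLinearMap.fst ℝ ℝ ℝ +
          mollify β G₂ p • ContinuousLinearMap.snd ℝ ℝ ℝ with hω
  have hωd : ∀ p x y, fderiv ℝ ω p x y =
      fderiv ℝ (mollify β G₁) p x * y.1 + fderiv ℝ (mollify β G₂) p x * y.2 := by
    intro p x y
    have e₁ := (d₁ p).hasFDerivAt.smul_const (ContinuousLinearMap.fst ℝ ℝ ℝ)
    have e₂ := (d₂ p).hasFDerivAt.smul_const (ContinuousLinearMap.snd ℝ ℝ ℝ)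
    have e₃ : fderiv ℝ ω p = _ := (e₁.add e₂).fderiv
    rw [e₃]
    simp
  obtain ⟨w, hw⟩ := hUc.exists_forall_hasFDerivAt_of_fderiv_symmetric hUo (ω := ω)
    (((d₁.smul_const _).add (d₂.smul_const _)).differentiableOn) (by
      intro p hp x y
      rw [hωd, hωd]
      have hxy : ∀ (G : ℝ × ℝ → ℝ) (z : ℝ × ℝ), fderiv ℝ G p z =
          z.1 * fderiv ℝ G p (1, 0) + z.2 * fderiv ℝ G p (0, 1) := fun G z => by
        rw [← smul_eq_mul, ← smul_eq_mul, ← map_smul, ← map_smul, ← map_add]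
        simp
      rw [hxy _ x, hxy _ y, hxy (mollify β G₂) x, hxy (mollify β G₂) y,
        h.fderiv_mollify_eq h₁ h₂ β hp]
      ring)
  have hlip : LipschitzOnWith (2 * C).toNNReal w U := by
    refine hUc.lipschitzOnWith_of_nnnorm_hasFDerivWithin_le
      (fun p hp => (hw p hp).hasFDerivWithinAt) fun p hp => ?_
    rw [← NNReal.coe_le_coe, coe_nnnorm]
    refine le_trans ?_ (Real.le_coe_toNNReal _)
    refine (norm_add_le _ _).trans ?_
    rw [norm_smul, norm_smul, two_mul]
    have e₁ := abs_mollify_le β h₁ b₁ hp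
    have e₂ := abs_mollify_le β h₂ b₂ hp
    refine add_le_add ?_ ?_
    · exact (mul_le_of_le_one_right (norm_nonneg _) (ContinuousLinearMap.norm_fst_le ..)).trans e₁
    · exact (mul_le_of_le_one_right (norm_nonneg _) (ContinuousLinearMap.norm_snd_le ..)).trans e₂
  obtain ⟨w', hw', heq⟩ := hlip.extend_real
  refine ⟨fun p => w' p - w' (0, 1), ?_, sub_self _, fun p hp => ?_⟩
  · exact LipschitzWith.of_dist_le_mul fun p q => by
      rw [dist_sub_right]; exact hw'.dist_le_mul p q
  · refine HasFDerivAt.sub_const _ ((hw p hp).congr_of_eventuallyEq ?_)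
    filter_upwards [hUo.mem_nhds hp] with q hq using (heq hq).symm

/-- A normalized sequence of uniformly Lipschitz functions has a pointwise convergent
subsequence. -/
theorem exists_subseq_tendsto_of_lipschitzWith {X : Type*} [PseudoMetricSpace X]
    [TopologicalSpace.SeparableSpace X] {K : NNReal} {w : ℕ → X → ℝ}
    (hw : ∀ n, LipschitzWith K (w n)) (x₀ : X) (h₀ : ∀ n, w n x₀ = 0) :
    ∃ (g : X → ℝ) (σ : ℕ → ℕ), StrictMono σ ∧ LipschitzWith K g ∧
      ∀ x, Tendsto (fun n => w (σ n) x) atTop (𝓝 (g x)) := by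
  have : Nonempty X := ⟨x₀⟩
  set e := TopologicalSpace.denseSeq X
  have hmem : ∀ n, (fun k => w n (e k)) ∈
      Set.pi univ fun k => Icc (-(K * dist (e k) x₀)) (K * dist (e k) x₀) := by
    intro n k _
    have := (hw n).dist_le_mul (e k) x₀
    rw [h₀, Real.dist_eq, sub_zero] at this
    exact abs_le.1 this
  obtain ⟨b, -, σ, hσ, hb⟩ := (isCompact_univ_pi fun k =>
    (isCompact_Icc : IsCompact (Icc (-(K * dist (e k) x₀)) (K * dist (e k) x₀)))).tendsto_subseq
      hmem
  have hcau : ∀ x, CauchySeq fun n => w (σ n) x := by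
    intro x
    rw [Metric.cauchySeq_iff']
    intro ε hε
    obtain ⟨k, hk⟩ := (TopologicalSpace.denseRange_denseSeq X).exists_dist_lt x
      (show 0 < ε / (4 * (K + 1)) by positivity)
    have hk' : K * dist x (e k) ≤ ε / 4 := by
      have h1 : (K : ℝ) * dist x (e k) ≤ (K + 1) * (ε / (4 * (K + 1))) :=
        mul_le_mul (by linarith) hk.le dist_nonneg (by positivity)
      have h2 : ((K : ℝ) + 1) * (ε / (4 * (K + 1))) = ε / 4 := by field_simp
      linarith
    have hc : CauchySeq fun n => w (σ n) (e k) := ((tendsto_pi_nhds.1 hb) k).cauchySeq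
    obtain ⟨N, hN⟩ := Metric.cauchySeq_iff'.1 hc (ε / 4) (by positivity)
    refine ⟨N, fun n hn => ?_⟩
    have h1 := hN n hn
    have h2 := (hw (σ n)).dist_le_mul x (e k)
    have h3 := (hw (σ N)).dist_le_mul (e k) x
    rw [dist_comm (e k) x] at h3
    have h4 := dist_triangle4 (w (σ n) x) (w (σ n) (e k)) (w (σ N) (e k)) (w (σ N) x)
    linarith
  choose g hg using fun x => cauchySeq_tendsto_of_complete (hcau x)
  refine ⟨g, σ, hσ, LipschitzWith.of_dist_le_mul fun x y => ?_, hg⟩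
  exact le_of_tendsto ((hg x).dist (hg y))
    (Eventually.of_forall fun n => (hw (σ n)).dist_le_mul x y)

/-- Pointwise limits of mollified potentials have the limit field as weak gradient, and for a
Lipschitz function the weak gradient is the gradient almost everywhere. -/
theorem ae_lineDeriv_eq_of_tendsto {w : ℕ → ℝ × ℝ → ℝ} {W : ℝ × ℝ → ℝ} {K L : NNReal}
    (hw : ∀ n, LipschitzWith K (w n)) {p₀ : ℝ × ℝ} (h₀ : ∀ n, w n p₀ = 0)
    (hW : LipschitzWith L W) (hlim : ∀ p, Tendsto (fun n => w n p) atTop (𝓝 (W p)))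
    {g : ℕ → ℝ × ℝ → ℝ} {G : ℝ × ℝ → ℝ} {C : ℝ} (hg : ∀ n, Continuous (g n))
    {ε : ℕ → ℝ} (hε : Tendsto ε atTop (𝓝 0))
    (hgC : ∀ n p, ε n < p.2 → |g n p| ≤ C) (hG : LocallyIntegrable G)
    (hgG : ∀ᵐ p, Tendsto (fun n => g n p) atTop (𝓝 (G p))) (d : ℝ × ℝ)
    (hd : ∀ n p, ε n < p.2 → lineDeriv ℝ (w n) p d = g n p) :
    ∀ᵐ p, p ∈ upperHalf → lineDeriv ℝ W p d = G p := by
  have key := isOpen_upperHalf.ae_eq_zero_of_integral_contDiff_smul_eq_zero (μ := volume)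
    (f := fun p => lineDeriv ℝ W p d - G p)
    (((hW.locallyIntegrable_lineDeriv d).sub hG).locallyIntegrableOn _) ?_
  · filter_upwards [key] with p hp hp' using sub_eq_zero.1 (hp hp')
  intro ψ hψ hc hsupp
  have hψ1 : ContDiff ℝ 1 ψ := hψ.of_le (WithTop.coe_le_coe.2 (le_top : (1 : ℕ∞) ≤ ⊤))
  obtain ⟨D, hD⟩ := hψ1.lipschitzWith_of_hasCompactSupport hc one_ne_zero
  have e : ∀ v p, lineDeriv ℝ ψ p v = fderiv ℝ ψ p v := fun v p =>
    (hψ1.differentiable one_ne_zero p).lineDeriv_eq_fderiv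
  -- the support of the test function keeps a positive distance from the boundary
  obtain ⟨δ, hδ, hδψ⟩ : ∃ δ > 0, ∀ p, ψ p ≠ 0 → δ ≤ p.2 := by
    by_cases hne : (tsupport ψ).Nonempty
    · obtain ⟨q, hq, hmin⟩ := hc.isCompact.exists_isMinOn hne continuous_snd.continuousOn
      exact ⟨q.2, hsupp hq, fun p hp => hmin (subset_tsupport ψ hp)⟩
    · exact ⟨1, one_pos, fun p hp => absurd ⟨p, subset_tsupport ψ hp⟩ hne⟩
  have hL : Tendsto (fun n => ∫ p, lineDeriv ℝ (w n) p d * ψ p) atTop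
      (𝓝 (∫ p, lineDeriv ℝ W p d * ψ p)) := by
    rw [hW.integral_lineDeriv_mul_eq hD hc]
    have : ∀ n, ∫ p, lineDeriv ℝ (w n) p d * ψ p = ∫ p, lineDeriv ℝ ψ p (-d) * w n p :=
      fun n => (hw n).integral_lineDeriv_mul_eq hD hc d
    simp only [this, e]
    have hfc : Continuous fun p => fderiv ℝ ψ p (-d) :=
      (hψ1.continuous_fderiv one_ne_zero).clm_apply continuous_const
    refine tendsto_integral_of_dominated_convergence
      (fun p => |fderiv ℝ ψ p (-d)| * (K * dist p p₀)) (fun n => ?_) ?_ (fun n => ?_) ?_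
    · exact (hfc.mul (hw n).continuous).aestronglyMeasurable
    · refine Continuous.integrable_of_hasCompactSupport ?_ ?_
      · fun_prop
      · exact ((hc.fderiv_apply ℝ (-d)).norm).mul_right
    · refine Eventually.of_forall fun p => ?_
      rw [norm_mul, Real.norm_eq_abs]
      refine mul_le_mul_of_nonneg_left ?_ (abs_nonneg _)
      have := (hw n).dist_le_mul p p₀
      rwa [h₀, dist_zero_right] at this
    · exact Eventually.of_forall fun p => (hlim p).const_mul _
  have hR : Tendsto (fun n => ∫ p, g n p * ψ p) atTop (𝓝 (∫ p, G p * ψ p)) := by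
    refine tendsto_integral_filter_of_dominated_convergence (fun p => C * |ψ p|) ?_ ?_ ?_ ?_
    · exact Eventually.of_forall fun n =>
        ((hg n).mul hψ1.continuous).aestronglyMeasurable
    · filter_upwards [hε.eventually_lt_const hδ] with n hn
      refine Eventually.of_forall fun p => ?_
      rw [norm_mul, Real.norm_eq_abs, Real.norm_eq_abs]
      by_cases hp : ψ p = 0
      · simp [hp]
      · exact mul_le_mul_of_nonneg_right (hgC n p (hn.trans_le (hδψ p hp))) (abs_nonneg _)
    · exact (Continuous.integrable_of_hasCompactSupport hψ1.continuous hc).abs.const_mul C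
    · filter_upwards [hgG] with p hp using hp.mul_const _
  have heq : ∫ p, lineDeriv ℝ W p d * ψ p = ∫ p, G p * ψ p := by
    refine tendsto_nhds_unique hL (hR.congr' ?_)
    filter_upwards [hε.eventually_lt_const hδ] with n hn
    refine integral_congr_ae (Eventually.of_forall fun p => ?_)
    simp only
    by_cases hp : ψ p = 0
    · simp [hp]
    · rw [hd n p (hn.trans_le (hδψ p hp))]
  have hI₁ : Integrable fun p => lineDeriv ℝ W p d * ψ p :=
    (hW.locallyIntegrable_lineDeriv d).integrable_smul_right_of_hasCompactSupport
      hψ1.continuous hc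
  have hI₂ : Integrable fun p => G p * ψ p :=
    hG.integrable_smul_right_of_hasCompactSupport hψ1.continuous hc
  rw [← sub_eq_zero, ← integral_sub hI₁ hI₂] at heq
  rw [← heq]
  refine integral_congr_ae (Eventually.of_forall fun p => ?_)
  simp only [smul_eq_mul]
  ring

/-- A bounded curl-free field on the upper half-plane is almost everywhere the gradient of a
Lipschitz function. An upper bound for the field in a fixed direction is inherited, along every
segment in that direction, by the increments of the potential. -/
theorem IsCurlFree.exists_potential {G₁ G₂ : ℝ × ℝ → ℝ} {C : ℝ}
    (h : IsCurlFree G₁ G₂) (h₁ : LocallyIntegrable G₁) (h₂ : LocallyIntegrable G₂)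
    (b₁ : ∀ p, |G₁ p| ≤ C) (b₂ : ∀ p, |G₂ p| ≤ C) :
    ∃ (K : NNReal) (W : ℝ × ℝ → ℝ), LipschitzWith K W ∧
      (∀ᵐ p, p ∈ upperHalf → lineDeriv ℝ W p (1, 0) = G₁ p) ∧
      (∀ᵐ p, p ∈ upperHalf → lineDeriv ℝ W p (0, 1) = G₂ p) ∧
      ∀ (d : ℝ × ℝ) (κ : ℝ), (∀ᵐ p, p ∈ upperHalf → d.1 * G₁ p + d.2 * G₂ p ≤ κ) →
        ∀ p ∈ upperHalf, p + d ∈ upperHalf → W (p + d) ≤ W p + κ := by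
  set β : ℕ → ContDiffBump (0 : ℝ × ℝ) := fun n =>
    ⟨1 / (2 * (n + 1)), 1 / (n + 1), by positivity, by
      apply one_div_lt_one_div_of_lt <;> [positivity; linarith [Nat.cast_nonneg (α := ℝ) n]]⟩
    with hβ
  have hβ0 : Tendsto (fun n => (β n).rOut) atTop (𝓝 0) := tendsto_one_div_add_atTop_nhds_zero_nat
  have hβK : ∀ n, (β n).rOut ≤ 2 * (β n).rIn := fun n => by
    simp only [hβ]
    apply le_of_eq
    field_simp
  choose w hwL hw0 hwd using fun n => h.exists_mollified_potential h₁ h₂ b₁ b₂ (β n)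
  obtain ⟨W, σ, hσ, hW, hlim⟩ := exists_subseq_tendsto_of_lipschitzWith hwL (0, 1) hw0
  have hε := hβ0.comp hσ.tendsto_atTop
  have hae : ∀ {G : ℝ × ℝ → ℝ}, LocallyIntegrable G →
      ∀ᵐ p, Tendsto (fun n => mollify (β (σ n)) G p) atTop (𝓝 (G p)) := fun hG =>
    ContDiffBump.ae_convolution_tendsto_right_of_locallyIntegrable (φ := fun n => β (σ n)) hε
      (Eventually.of_forall fun n => hβK (σ n)) hG
  refine ⟨_, W, hW, ?_, ?_, ?_⟩
  · refine ae_lineDeriv_eq_of_tendsto (fun n => hwL (σ n)) (fun n => hw0 (σ n)) hW hlim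
      (fun n => (contDiff_mollify (β (σ n)) h₁).continuous) hε
      (fun n p hp => abs_mollify_le _ h₁ b₁ hp) h₁ (hae h₁) _ fun n p hp => ?_
    rw [(hwd (σ n) p hp).differentiableAt.lineDeriv_eq_fderiv, (hwd (σ n) p hp).fderiv]
    simp
  · refine ae_lineDeriv_eq_of_tendsto (fun n => hwL (σ n)) (fun n => hw0 (σ n)) hW hlim
      (fun n => (contDiff_mollify (β (σ n)) h₂).continuous) hε
      (fun n p hp => abs_mollify_le _ h₂ b₂ hp) h₂ (hae h₂) _ fun n p hp => ?_
    rw [(hwd (σ n) p hp).differentiableAt.lineDeriv_eq_fderiv, (hwd (σ n) p hp).fderiv]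
    simp
  · intro d κ hκ p hp hpd
    refine le_of_tendsto_of_tendsto (hlim (p + d)) ((hlim p).add_const κ) ?_
    filter_upwards [hε.eventually_lt_const (lt_min hp hpd)] with n hn
    have hn1 : (β (σ n)).rOut < p.2 := hn.trans_le (min_le_left _ _)
    have hn2 : (β (σ n)).rOut < p.2 + d.2 := hn.trans_le (min_le_right _ _)
    have hseg : ∀ s ∈ Icc (0 : ℝ) 1, (β (σ n)).rOut < (p + s • d).2 := by
      intro s hs
      have := convex_Ioi (β (σ n)).rOut hn1 hn2 (sub_nonneg.2 hs.2) hs.1 (by ring)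
      simp only [smul_eq_mul, mem_Ioi] at this
      simp only [Prod.snd_add, Prod.smul_snd, smul_eq_mul]
      linarith
    have hline : ∀ s ∈ Icc (0 : ℝ) 1, HasDerivAt (fun s : ℝ => w (σ n) (p + s • d))
        (d.1 * mollify (β (σ n)) G₁ (p + s • d) + d.2 * mollify (β (σ n)) G₂ (p + s • d)) s := by
      intro s hs
      have hγ : HasDerivAt (fun s : ℝ => p + s • d) d s := by
        simpa using! ((hasDerivAt_id s).smul_const d).const_add p
      have := (hwd (σ n) _ (hseg s hs)).comp_hasDerivAt s hγ
      convert! this using 1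
      simp
      ring
    have hbd : ∀ s ∈ Icc (0 : ℝ) 1, d.1 * mollify (β (σ n)) G₁ (p + s • d) +
        d.2 * mollify (β (σ n)) G₂ (p + s • d) ≤ κ := by
      intro s hs
      have e : d.1 * mollify (β (σ n)) G₁ (p + s • d) + d.2 * mollify (β (σ n)) G₂ (p + s • d) =
          mollify (β (σ n)) (fun q => d.1 * G₁ q + d.2 * G₂ q) (p + s • d) := by
        simp only [mollify_apply]
        rw [← integral_const_mul, ← integral_const_mul, ← integral_add
          ((integrable_normed_sub_mul _ h₁ _).const_mul _)
          ((integrable_normed_sub_mul _ h₂ _).const_mul _)]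
        refine integral_congr_ae (Eventually.of_forall fun q => ?_)
        simp only
        ring
      rw [e]
      exact mollify_le _ ((h₁.smul d.1).add (h₂.smul d.2)) hκ (hseg s hs)
    have := image_le_of_deriv_right_le_deriv_boundary (a := (0 : ℝ)) (b := 1)
      (B := fun s => w (σ n) p + s * κ) (B' := fun _ => κ)
      (fun s hs => (hline s hs).continuousAt.continuousWithinAt)
      (fun s hs => (hline s (Ico_subset_Icc_self hs)).hasDerivWithinAt) (by simp)
      (by fun_prop)
      (fun s _ => by
        simpa using! (((hasDerivAt_id s).mul_const κ).const_add (w (σ n) p)).hasDerivWithinAt)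
      (fun s hs => hbd s (Ico_subset_Icc_self hs)) (right_mem_Icc.2 zero_le_one)
    simpa using this

/-! ### A comparison principle for one-sided Lipschitz transport -/

theorem exists_lipschitzWith_mul {X : Type*} [PseudoMetricSpace X] {g k : X → ℝ} {K L : NNReal}
    {a b : ℝ} (hg : LipschitzWith K g) (hk : LipschitzWith L k) (ha : ∀ x, |g x| ≤ a)
    (hb : ∀ x, |k x| ≤ b) : ∃ D, LipschitzWith D fun x => g x * k x := by
  refine ⟨_, LipschitzWith.of_dist_le' (K := a * L + K * b) fun x y => ?_⟩
  have h1 := hg.dist_le_mul x y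
  have h2 := hk.dist_le_mul x y
  rw [Real.dist_eq] at *
  rw [show g x * k x - g y * k y = g x * (k x - k y) + (g x - g y) * k y by ring]
  refine (abs_add_le _ _).trans ?_
  rw [abs_mul, abs_mul]
  have h3 := mul_le_mul (ha x) h2 (abs_nonneg _) ((abs_nonneg _).trans (ha x))
  have h4 := mul_le_mul h1 (hb y) (abs_nonneg _) (by positivity)
  linarith

theorem abs_exp_neg_sub_exp_neg_le {a b : ℝ} (ha : 0 ≤ a) (hb : 0 ≤ b) :
    |Real.exp (-a) - Real.exp (-b)| ≤ |a - b| := by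
  wlog hab : a ≤ b generalizing a b
  · rw [abs_sub_comm, abs_sub_comm a]
    exact this hb ha (le_of_not_ge hab)
  have h1 : Real.exp (-b) = Real.exp (-a) * Real.exp (-(b - a)) := by
    rw [← Real.exp_add]; ring_nf
  have h2 := Real.add_one_le_exp (-(b - a))
  have h3 : Real.exp (-a) ≤ 1 := Real.exp_le_one_iff.2 (by linarith)
  have h4 : Real.exp (-b) ≤ Real.exp (-a) := Real.exp_le_exp.2 (by linarith)
  rw [abs_of_nonneg (by linarith), abs_of_nonpos (by linarith), h1]
  nlinarith [Real.exp_pos (-a), Real.exp_pos (-(b - a)),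
    mul_le_mul h3 (show 1 - Real.exp (-(b - a)) ≤ b - a by linarith)
      (by linarith [Real.exp_le_one_iff.2 (show -(b - a) ≤ 0 by linarith)]) zero_le_one]

/-- Integration by parts against a function `g` that need not be differentiable but grows along `e`
at most at the rate `c` on the support of `F`. The shift is applied to `g` in the difference
quotients of `F`. -/
theorem neg_mul_integral_le_integral_lineDeriv_mul {F g : ℝ × ℝ → ℝ} {K : NNReal}
    (hF : LipschitzWith K F) (hc : HasCompactSupport F) (hF0 : ∀ p, 0 ≤ F p)
    (hg : Integrable g) {A : ℝ} (hA : ∀ p, |g p| ≤ A) (e : ℝ × ℝ) {c : ℝ}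
    (hcg : ∀ p, F p ≠ 0 → ∀ s ∈ Ioo (0 : ℝ) 1, g p - g (p - s • e) ≤ s * c) :
    -(c * ∫ p, F p) ≤ ∫ p, lineDeriv ℝ F p e * g p := by
  refine ge_of_tendsto (hF.integral_inv_smul_sub_mul_tendsto_integral_lineDeriv_mul hg e) ?_
  filter_upwards [Ioo_mem_nhdsGT (zero_lt_one' ℝ)] with s hs
  have hFI : Integrable F := hF.continuous.integrable_of_hasCompactSupport hc
  have hI1 : Integrable fun p => F p * g p :=
    hFI.mul_bdd (c := A) hg.aestronglyMeasurable (Eventually.of_forall hA)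
  have hI2 : Integrable fun p => F (p + s • e) * g p :=
    (hFI.comp_add_right (s • e)).mul_bdd (c := A) hg.aestronglyMeasurable (Eventually.of_forall hA)
  have hI3 : Integrable fun p => F p * g (p - s • e) :=
    hFI.mul_bdd (c := A) (hg.comp_sub_right (s • e)).aestronglyMeasurable
      (Eventually.of_forall fun p => hA _)
  have hshift : ∫ p, F (p + s • e) * g p = ∫ p, F p * g (p - s • e) := by
    rw [← integral_add_right_eq_self (fun p => F p * g (p - s • e)) (s • e)]
    simp
  have h1 : ∫ p, (s⁻¹ • (F (p + s • e) - F p)) * g p =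
      s⁻¹ * ∫ p, (F p * g (p - s • e) - F p * g p) := by
    rw [integral_sub hI3 hI1, ← hshift, ← integral_sub hI2 hI1, ← integral_const_mul]
    refine integral_congr_ae (Eventually.of_forall fun p => ?_)
    simp only [smul_eq_mul]
    ring
  have h2 : ∫ p, -(s * c) * F p ≤ ∫ p, (F p * g (p - s • e) - F p * g p) := by
    refine integral_mono (hFI.const_mul _) (hI3.sub hI1) fun p => ?_
    by_cases hp : F p = 0
    · simp [hp]
    · have := mul_le_mul_of_nonneg_left (hcg p hp s hs) (hF0 p)
      simp only
      linarith
  rw [integral_const_mul] at h2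
  rw [h1]
  have := mul_le_mul_of_nonneg_left h2 (inv_nonneg.2 hs.1.le)
  refine le_trans (le_of_eq ?_) this
  have := hs.1.ne'
  field_simp

/-- The truncation `min (max (z - ε) 0) 1` increases at most as much as `z` does. -/
theorem clamp_le_add (ε a b : ℝ) :
    min (max (b - ε) 0) 1 ≤ min (max (a - ε) 0) 1 + max 0 (b - a) := by
  rcases le_total a b with h | h
  · rw [max_eq_right (sub_nonneg.2 h)]
    rcases le_total (b - ε) 0 with h1 | h1 <;> rcases le_total (a - ε) 0 with h2 | h2 <;>
      simp only [h1, h2, max_eq_left, max_eq_right] <;> grind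
  · rw [max_eq_left (sub_nonpos.2 h), add_zero]
    gcongr

/-- The positive part of `R - |x| - A t`, which is supported in a backward cone, multiplied by the
exponential weight `exp (-C t)`. The time variable enters through its positive part, which keeps
the weight bounded on the whole plane. -/
noncomputable def coneWeight (R A C : ℝ) (p : ℝ × ℝ) : ℝ :=
  max 0 (R - |p.1| - A * max p.2 0) * Real.exp (-(C * max p.2 0))

theorem coneWeight_nonneg (R A C : ℝ) (p : ℝ × ℝ) : 0 ≤ coneWeight R A C p :=
  mul_nonneg (le_max_left _ _) (Real.exp_pos _).le

theorem lipschitzWith_max_snd : LipschitzWith 1 fun p : ℝ × ℝ => max p.2 0 :=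
  LipschitzWith.prod_snd.max_const 0

theorem abs_coneWeight_le {R A C : ℝ} (hR : 0 ≤ R) (hA : 0 ≤ A) (hC : 0 ≤ C) (p : ℝ × ℝ) :
    |coneWeight R A C p| ≤ R := by
  rw [abs_of_nonneg (coneWeight_nonneg R A C p)]
  have h1 : max 0 (R - |p.1| - A * max p.2 0) ≤ R := by
    have := abs_nonneg p.1
    have := mul_nonneg hA (le_max_right p.2 0)
    exact max_le hR (by linarith)
  have h2 : Real.exp (-(C * max p.2 0)) ≤ 1 := Real.exp_le_one_iff.2
    (neg_nonpos.2 (mul_nonneg hC (le_max_right p.2 0)))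
  exact (mul_le_mul h1 h2 (Real.exp_pos _).le hR).trans_eq (mul_one R)

theorem exists_lipschitzWith_coneWeight {R A C : ℝ} (hR : 0 ≤ R) (hA : 0 ≤ A) (hC : 0 ≤ C) :
    ∃ D, LipschitzWith D (coneWeight R A C) := by
  have hm := lipschitzWith_max_snd
  have h1 : LipschitzWith (1 + A).toNNReal fun p : ℝ × ℝ => R - |p.1| - A * max p.2 0 := by
    refine LipschitzWith.of_dist_le' fun p q => ?_
    have e1 : |p.1 - q.1| ≤ dist p q := by rw [← Real.dist_eq]; exact le_max_left _ _
    have e2 : |max p.2 0 - max q.2 0| ≤ dist p q := by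
      simpa [Real.dist_eq] using hm.dist_le_mul p q
    have e3 := abs_abs_sub_abs_le_abs_sub q.1 p.1
    rw [abs_sub_comm q.1] at e3
    have e4 := mul_le_mul_of_nonneg_left e2 hA
    rw [Real.dist_eq, show R - |p.1| - A * max p.2 0 - (R - |q.1| - A * max q.2 0) =
      (|q.1| - |p.1|) - A * (max p.2 0 - max q.2 0) by ring]
    refine (abs_sub _ _).trans ?_
    rw [abs_mul, abs_of_nonneg hA]
    linarith
  have h2 : LipschitzWith C.toNNReal fun p : ℝ × ℝ => Real.exp (-(C * max p.2 0)) := by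
    refine LipschitzWith.of_dist_le' fun p q => ?_
    have e2 : |max p.2 0 - max q.2 0| ≤ dist p q := by
      simpa [Real.dist_eq] using hm.dist_le_mul p q
    have := abs_exp_neg_sub_exp_neg_le (mul_nonneg hC (le_max_right p.2 0))
      (mul_nonneg hC (le_max_right q.2 0))
    rw [← mul_sub, abs_mul, abs_of_nonneg hC] at this
    exact this.trans (mul_le_mul_of_nonneg_left e2 hC)
  refine exists_lipschitzWith_mul (a := R) (b := 1) (h1.const_max 0) h2 (fun p => ?_) fun p => ?_
  · rw [abs_of_nonneg (le_max_left _ _)]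
    have := abs_nonneg p.1
    have := mul_nonneg hA (le_max_right p.2 0)
    exact max_le hR (by linarith)
  · rw [abs_of_nonneg (Real.exp_pos _).le]
    exact Real.exp_le_one_iff.2 (neg_nonpos.2 (mul_nonneg hC (le_max_right p.2 0)))

/-- Along directions of speed at most `A`, the weight decays at the exponential rate `C`. -/
theorem coneWeight_add_le (R C : ℝ) {A α s : ℝ} {p : ℝ × ℝ} (hα : |α| ≤ A)
    (hs : 0 ≤ s) (hp : 0 < p.2) :
    coneWeight R A C (p + s • (α, 1)) ≤ coneWeight R A C p * Real.exp (-(C * s)) := by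
  unfold coneWeight
  simp only [Prod.fst_add, Prod.snd_add, Prod.smul_mk, smul_eq_mul, mul_one]
  rw [max_eq_left hp.le, max_eq_left (by linarith : 0 ≤ p.2 + s), mul_assoc, ← Real.exp_add,
    show -(C * p.2) + -(C * s) = -(C * (p.2 + s)) by ring]
  refine mul_le_mul_of_nonneg_right (max_le_max le_rfl ?_) (Real.exp_pos _).le
  have h1 : |p.1| ≤ |p.1 + s * α| + |s * α| := by
    simpa using abs_sub (p.1 + s * α) (s * α)
  have h2 : |s * α| ≤ s * A := by
    rw [abs_mul, abs_of_nonneg hs]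
    exact mul_le_mul_of_nonneg_left hα hs
  linarith

/-- A Lipschitz subsolution of the transport equation `z_t + g z_x = 0` that vanishes initially is
nonpositive, provided that `g` is bounded and satisfies the one-sided bound `g_x ≤ 1 / t`. The
truncation of `z` at a positive level vanishes for small times, which removes the singularity of
`1 / t`, and the weight `exp (-C t)` then absorbs the compression of the flow. -/
theorem nonpos_of_transport {z g : ℝ × ℝ → ℝ} {K : NNReal} (hz : LipschitzWith K z)
    (hz0 : ∀ p : ℝ × ℝ, p.2 ≤ 0 → z p = 0)
    (hgm : AEStronglyMeasurable g (volume.restrict upperHalf)) {A : ℝ}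
    (hA : ∀ p ∈ upperHalf, |g p| ≤ A)
    (hg : ∀ x₁ x₂ t : ℝ, x₁ < x₂ → 0 < t → g (x₂, t) - g (x₁, t) ≤ (x₂ - x₁) / t)
    (htr : ∀ᵐ p, p ∈ upperHalf → DifferentiableAt ℝ z p ∧ fderiv ℝ z p (g p, 1) ≤ 0) :
    ∀ p ∈ upperHalf, z p ≤ 0 := by
  intro p₀ hp₀
  by_contra! hpos
  wlog hA1 : 1 ≤ A generalizing A
  · exact this (A := 1) (fun p hp => (hA p hp).trans (le_of_not_ge hA1)) le_rfl
  set ε := z p₀ / 2 with hε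
  have hεp : 0 < ε := half_pos hpos
  set δ := ε / (K + 1) with hδ
  have hδp : 0 < δ := by positivity
  set C := δ⁻¹ + 1 with hC
  have hCp : 0 ≤ C := by positivity
  set R := |p₀.1| + A * p₀.2 + 1 with hR
  have hp₀' : 0 < p₀.2 := hp₀
  have hRp : 0 ≤ R := by positivity
  set zt : ℝ × ℝ → ℝ := fun p => min (max (z p - ε) 0) 1 with hzt
  have hztL : LipschitzWith K zt := by
    refine LipschitzWith.min_const (LipschitzWith.max_const ?_ 0) 1
    exact LipschitzWith.of_dist_le_mul fun p q => by
      rw [dist_sub_right]; exact hz.dist_le_mul p q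
  have hzt0 : ∀ p, 0 ≤ zt p := fun p => le_min (le_max_right _ _) zero_le_one
  have hzt1 : ∀ p, |zt p| ≤ 1 := fun p => by
    rw [abs_of_nonneg (hzt0 p)]; exact min_le_right _ _
  have hztδ : ∀ p : ℝ × ℝ, p.2 < δ → zt p = 0 := by
    intro p hp
    have : z p ≤ ε := by
      rcases le_or_gt p.2 0 with h0 | h0
      · rw [hz0 p h0]; exact hεp.le
      have h1 := hz.dist_le_mul p (p.1, 0)
      rw [hz0 (p.1, 0) le_rfl, Real.dist_eq, sub_zero, Prod.dist_eq, dist_self, Real.dist_eq,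
        sub_zero, abs_of_pos h0, max_eq_right h0.le] at h1
      have h2 : (K : ℝ) * p.2 ≤ (K + 1) * δ :=
        mul_le_mul (by linarith) hp.le h0.le (by positivity)
      have h3 : ((K : ℝ) + 1) * δ = ε := by rw [hδ]; field_simp
      linarith [le_abs_self (z p)]
    simp only [hzt]
    rw [max_eq_right (by linarith), min_eq_left zero_le_one]
  set η := coneWeight R A C with hη
  have hA0 : 0 ≤ A := zero_le_one.trans hA1
  obtain ⟨D, hηL⟩ := exists_lipschitzWith_coneWeight hRp hA0 hCp
  set F : ℝ × ℝ → ℝ := fun p => zt p * η p with hF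
  obtain ⟨D', hFL⟩ := exists_lipschitzWith_mul hztL hηL hzt1 (abs_coneWeight_le hRp hA0 hCp)
  have hF0 : ∀ p, 0 ≤ F p := fun p => mul_nonneg (hzt0 p) (coneWeight_nonneg R A C p)
  have hsupp : ∀ p, F p ≠ 0 → p ∈ Icc (-R) R ×ˢ Icc δ R := by
    intro p hp
    have hz' : zt p ≠ 0 := left_ne_zero_of_mul hp
    have hη' : η p ≠ 0 := right_ne_zero_of_mul hp
    have hpδ : δ ≤ p.2 := by
      by_contra! hlt
      exact hz' (hztδ p hlt)
    have hpos' : 0 < R - |p.1| - A * max p.2 0 := by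
      by_contra! hle
      exact left_ne_zero_of_mul hη' (max_eq_left hle)
    rw [max_eq_left (hδp.le.trans hpδ)] at hpos'
    have h1 : p.2 ≤ A * p.2 := le_mul_of_one_le_left (hδp.le.trans hpδ) hA1
    have h2 := abs_nonneg p.1
    refine ⟨abs_le.1 ?_, hpδ, ?_⟩ <;> linarith
  have htsupp : tsupport F ⊆ Icc (-R) R ×ˢ Icc δ R :=
    closure_minimal hsupp (isClosed_Icc.prod isClosed_Icc)
  have hFc : HasCompactSupport F :=
    HasCompactSupport.of_support_subset_isCompact (isCompact_Icc.prod isCompact_Icc) hsupp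
  -- the velocity, cut off outside a neighbourhood (in `x`) of the support of `F`
  set S : Set (ℝ × ℝ) := Icc (-(R + 1)) (R + 1) ×ˢ Icc δ R with hS
  have hSm : MeasurableSet S := measurableSet_Icc.prod measurableSet_Icc
  have hSH : S ⊆ upperHalf := fun p hp => hδp.trans_le hp.2.1
  set k : ℝ × ℝ → ℝ := S.indicator g with hk
  have hkA : ∀ p, |k p| ≤ A := by
    intro p
    by_cases hp : p ∈ S
    · rw [hk, indicator_of_mem hp]; exact hA p (hSH hp)
    · rw [hk, indicator_of_notMem hp, abs_zero]; exact hA0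
  have hkI : Integrable k := by
    refine IntegrableOn.integrable_indicator ?_ hSm
    have : IsFiniteMeasure (volume.restrict S) :=
      isFiniteMeasure_restrict.2 (isCompact_Icc.prod isCompact_Icc).measure_lt_top.ne
    refine Integrable.of_bound (hgm.mono_measure (Measure.restrict_mono hSH le_rfl)) A ?_
    filter_upwards [ae_restrict_mem hSm] with p hp using hA p (hSH hp)
  have hI2 := neg_mul_integral_le_integral_lineDeriv_mul hFL hFc hF0 hkI hkA (1, 0) (c := δ⁻¹) (by
    intro p hp s hs
    obtain ⟨h1, h2⟩ := hsupp p hp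
    have m1 : p ∈ S := ⟨⟨by linarith [h1.1], by linarith [h1.2]⟩, h2⟩
    have m2 : p - s • ((1 : ℝ), (0 : ℝ)) ∈ S := by
      simp only [hS, mem_prod, Prod.fst_sub, Prod.snd_sub, Prod.smul_mk, smul_eq_mul, mul_one,
        mul_zero, sub_zero]
      exact ⟨⟨by linarith [h1.1, hs.2], by linarith [h1.2, hs.1]⟩, h2⟩
    rw [hk, indicator_of_mem m1, indicator_of_mem m2]
    have := hg (p.1 - s) p.1 p.2 (by linarith [hs.1]) (hδp.trans_le h2.1)
    rw [sub_sub_cancel] at this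
    have e : p - s • ((1 : ℝ), (0 : ℝ)) = (p.1 - s, p.2) := by ext <;> simp
    rw [e]
    refine this.trans ?_
    rw [div_eq_mul_inv]
    exact mul_le_mul_of_nonneg_left (inv_anti₀ hδp h2.1) hs.1.le)
  have hout : ∀ p, p ∉ tsupport F → ∀ e, lineDeriv ℝ F p e = 0 := by
    intro p hp e
    rw [(notMem_tsupport_iff_eventuallyEq.1 hp).lineDeriv_eq]
    simp [lineDeriv]
  have hI1 : ∫ p, lineDeriv ℝ F p (0, 1) = 0 := by
    have := (LipschitzWith.const (1 : ℝ)).integral_lineDeriv_mul_eq (μ := volume)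
      (f := fun _ : ℝ × ℝ => (1 : ℝ)) hFL hFc (0, -1)
    have h0 : ∀ p : ℝ × ℝ, lineDeriv ℝ (fun _ : ℝ × ℝ => (1 : ℝ)) p (0, -1) = 0 := fun p => by
      simp [lineDeriv]
    simpa [h0] using this.symm
  have hpt : ∀ᵐ p, lineDeriv ℝ F p (0, 1) + lineDeriv ℝ F p (1, 0) * k p ≤ -C * F p := by
    filter_upwards [hFL.ae_differentiableAt, htr] with p hFp hp
    by_cases hmem : p ∈ tsupport F
    · obtain ⟨h1, h2⟩ := htsupp hmem
      have hpS : p ∈ S := ⟨⟨by linarith [h1.1], by linarith [h1.2]⟩, h2⟩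
      have hpt : 0 < p.2 := hSH hpS
      obtain ⟨hzp, hzle⟩ := hp hpt
      rw [hk, indicator_of_mem hpS, hFp.lineDeriv_eq_fderiv, hFp.lineDeriv_eq_fderiv]
      have hlin : fderiv ℝ F p (0, 1) + fderiv ℝ F p (1, 0) * g p = fderiv ℝ F p (g p, 1) := by
        rw [mul_comm, ← smul_eq_mul, ← map_smul, ← map_add]
        simp
      rw [hlin]
      have hd1 := (hFp.hasFDerivAt.hasLineDerivAt (g p, 1)).tendsto_slope_zero_right
      have hd2 := (hzp.hasFDerivAt.hasLineDerivAt (g p, 1)).tendsto_slope_zero_right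
      have hd3 : HasDerivAt (fun s : ℝ => Real.exp (-(C * s))) (-C) 0 := by
        simpa using! ((hasDerivAt_id (0 : ℝ)).const_mul C).neg.exp
      have hd4 := (hasDerivAt_iff_tendsto_slope_zero.1 hd3).mono_left
        (nhdsWithin_mono 0 (s := Ioi 0) fun s hs => ne_of_gt hs)
      have hd5 := (hd4.const_mul (F p)).add
        ((tendsto_const_nhds (x := (0 : ℝ)).max hd2).mul_const (η p))
      rw [max_eq_left hzle, zero_mul, add_zero, mul_comm (F p)] at hd5
      refine le_of_tendsto_of_tendsto hd1 hd5 ?_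
      filter_upwards [self_mem_nhdsWithin] with s hs
      have hs : 0 < s := hs
      simp only [smul_eq_mul, zero_add, mul_zero, neg_zero, Real.exp_zero]
      have e1 : zt (p + s • (g p, 1)) ≤ zt p + max 0 (z (p + s • (g p, 1)) - z p) :=
        clamp_le_add ε _ _
      have e2 : η (p + s • (g p, 1)) ≤ η p * Real.exp (-(C * s)) :=
        coneWeight_add_le R C (hA p hpt) hs.le hpt
      have e3 : Real.exp (-(C * s)) ≤ 1 :=
        Real.exp_le_one_iff.2 (neg_nonpos.2 (mul_nonneg hCp hs.le))
      have e4 : 0 ≤ max 0 (z (p + s • (g p, 1)) - z p) := le_max_left _ _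
      have e5 : F (p + s • (g p, 1)) ≤
          F p * Real.exp (-(C * s)) + max 0 (z (p + s • (g p, 1)) - z p) * η p := by
        refine (mul_le_mul e1 e2 (coneWeight_nonneg R A C _) (add_nonneg (hzt0 p) e4)).trans ?_
        have := mul_le_mul_of_nonneg_left e3 (mul_nonneg e4 (coneWeight_nonneg R A C p))
        simp only [hF]
        linarith
      have e6 : max 0 (s⁻¹ * (z (p + s • (g p, 1)) - z p)) =
          s⁻¹ * max 0 (z (p + s • (g p, 1)) - z p) := by
        rw [mul_max_of_nonneg _ _ (inv_nonneg.2 hs.le), mul_zero]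
      rw [e6]
      have := mul_le_mul_of_nonneg_left e5 (inv_nonneg.2 hs.le)
      linarith
    · rw [hout p hmem, hout p hmem, image_eq_zero_of_notMem_tsupport hmem]
      simp
  have hD2 : Integrable fun p => lineDeriv ℝ F p (0, 1) := by
    refine (integrableOn_iff_integrable_of_support_subset (s := tsupport F) fun p hp => ?_).1
      ((hFL.locallyIntegrable_lineDeriv _).integrableOn_isCompact hFc)
    by_contra hmem
    exact hp (hout p hmem _)
  have hD1 : Integrable fun p => lineDeriv ℝ F p (1, 0) * k p :=
    hkI.bdd_mul (hFL.memLp_lineDeriv (μ := volume) (1, 0)).aestronglyMeasurable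
      (Eventually.of_forall fun p => norm_lineDeriv_le_of_lipschitz ℝ hFL)
  have hFI : Integrable F := hFL.continuous.integrable_of_hasCompactSupport hFc
  have hfin := integral_mono_ae (hD2.add hD1) (hFI.const_mul (-C)) hpt
  simp only [Pi.add_apply] at hfin
  rw [integral_add hD2 hD1, hI1, zero_add, integral_const_mul] at hfin
  have hFp₀ : F p₀ ≠ 0 := by
    have h1 : 0 < zt p₀ := lt_min (lt_max_of_lt_left (by rw [hε]; linarith)) one_pos
    have h2 : 0 < η p₀ := by
      refine mul_pos (lt_max_of_lt_right ?_) (Real.exp_pos _)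
      rw [max_eq_left hp₀'.le, hR]
      linarith
    exact (mul_pos h1 h2).ne'
  have hpos' := hFL.continuous.integral_pos_of_hasCompactSupport_nonneg_nonzero (μ := volume)
    hFc hF0 hFp₀
  rw [hC] at hfin
  linarith

/-! ### Uniqueness of entropy solutions -/

/-- The field `(v, -f(v))` of a weak solution, extended by zero, is curl-free. -/
theorem IsWeakSolution.isCurlFree {f φ : ℝ → ℝ} {v : ℝ → ℝ → ℝ} (hv : IsWeakSolution f φ v) :
    IsCurlFree (upperHalf.indicator fun p => v p.1 p.2)
      (upperHalf.indicator fun p => -f (v p.1 p.2)) := by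
  intro ψ hψ hc hsupp
  refine ((setIntegral_eq_integral_of_forall_compl_eq_zero (s := upperHalf) fun p hp => ?_).symm.trans
    (setIntegral_congr_fun measurableSet_upperHalf fun p hp => ?_)).trans
    (hv.equation ψ hψ hc hsupp)
  · simp [indicator_of_notMem hp]
  · simp only [indicator_of_mem hp]
    ring

theorem ae_intervalIntegral_eq_sub {W : ℝ × ℝ → ℝ} {K : NNReal}
    (hW : LipschitzWith K W) {v : ℝ → ℝ → ℝ}
    (h₁ : ∀ᵐ p : ℝ × ℝ, p ∈ upperHalf → lineDeriv ℝ W p (1, 0) = v p.1 p.2) :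
    ∀ᵐ t : ℝ, 0 < t → ∀ a b : ℝ, ∫ x in a..b, v x t = W (b, t) - W (a, t) := by
  have h : ∀ᵐ p : ℝ × ℝ, p ∈ upperHalf → HasDerivAt (fun y => W (y, p.2)) (v p.1 p.2) p.1 := by
    filter_upwards [h₁, hW.ae_differentiableAt] with p hp hd hpH
    rw [← hp hpH, hd.lineDeriv_eq_fderiv]
    exact hd.hasFDerivAt.comp_hasDerivAt p.1
      ((hasDerivAt_id p.1).prodMk (hasDerivAt_const p.1 p.2))
  have hswap := Measure.ae_ae_of_ae_prod
    ((Measure.measurePreserving_swap (μ := (volume : Measure ℝ))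
      (ν := (volume : Measure ℝ))).quasiMeasurePreserving.ae h)
  filter_upwards [hswap] with t ht htpos a b
  refine (intervalIntegrable_of_ae_deriv (hW.comp (LipschitzWith.prodMk_right t)) ?_ a b).2
  filter_upwards [ht] with x hx using hx htpos

/-- A weak solution is the `x`-derivative of a Lipschitz function `W` with `W_t = -f(W_x)` and
`W(·, 0)` a primitive of the initial datum. Convexity of `f` bounds the increments of `W` along
lines of any characteristic speed. -/
theorem IsWeakSolution.exists_potential {f φ : ℝ → ℝ} {M : ℝ} (h : IsAdmissible f φ M)
    {v : ℝ → ℝ → ℝ} (hv : IsWeakSolution f φ v) :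
    ∃ (K : NNReal) (W : ℝ × ℝ → ℝ), LipschitzWith K W ∧
      (∀ᵐ p : ℝ × ℝ, p ∈ upperHalf → lineDeriv ℝ W p (1, 0) = v p.1 p.2) ∧
      (∀ᵐ p : ℝ × ℝ, p ∈ upperHalf → lineDeriv ℝ W p (0, 1) = -f (v p.1 p.2)) ∧
      (∀ x, W (x, 0) = prim φ x) ∧
      ∀ c, ∀ p ∈ upperHalf, ∀ s, 0 ≤ s →
        W (p + s • (deriv f c, 1)) ≤ W p + s * legendre f c := by
  obtain ⟨M', hM'⟩ := hv.bounded
  obtain ⟨B, hB⟩ := isCompact_Icc.exists_bound_of_continuousOn (s := Icc (-M') M')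
    h.differentiable.continuous.continuousOn
  set C := max M' B
  set G₁ : ℝ × ℝ → ℝ := upperHalf.indicator fun p => v p.1 p.2 with hG₁
  set G₂ : ℝ × ℝ → ℝ := upperHalf.indicator fun p => -f (v p.1 p.2) with hG₂
  have hC0 : 0 ≤ C := (abs_nonneg _).trans ((hM' 0 1 one_pos).trans (le_max_left _ _))
  have b₁ : ∀ p, |G₁ p| ≤ C := by
    intro p
    by_cases hp : p ∈ upperHalf
    · rw [hG₁, indicator_of_mem hp]
      exact (hM' p.1 p.2 hp).trans (le_max_left _ _)
    · rwa [hG₁, indicator_of_notMem hp, abs_zero]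
  have b₂ : ∀ p, |G₂ p| ≤ C := by
    intro p
    by_cases hp : p ∈ upperHalf
    · rw [hG₂, indicator_of_mem hp, abs_neg]
      exact (hB _ (abs_le.1 (hM' p.1 p.2 hp))).trans (le_max_right _ _)
    · rwa [hG₂, indicator_of_notMem hp, abs_zero]
  have m₁ : AEStronglyMeasurable G₁ volume :=
    ((aemeasurable_indicator_iff measurableSet_upperHalf).2 hv.measurable).aestronglyMeasurable
  have m₂ : AEStronglyMeasurable G₂ volume :=
    ((aemeasurable_indicator_iff measurableSet_upperHalf).2
      (h.differentiable.continuous.measurable.comp_aemeasurable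
        hv.measurable).neg).aestronglyMeasurable
  have l₁ : LocallyIntegrable G₁ :=
    (memLp_top_of_bound m₁ C (Eventually.of_forall b₁)).locallyIntegrable le_top
  have l₂ : LocallyIntegrable G₂ :=
    (memLp_top_of_bound m₂ C (Eventually.of_forall b₂)).locallyIntegrable le_top
  obtain ⟨K, W, hW, hW₁, hW₂, hWd⟩ := hv.isCurlFree.exists_potential l₁ l₂ b₁ b₂
  have hW₁' : ∀ᵐ p : ℝ × ℝ, p ∈ upperHalf → lineDeriv ℝ W p (1, 0) = v p.1 p.2 := by
    filter_upwards [hW₁] with p hp hpH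
    rw [hp hpH, indicator_of_mem hpH]
  have hW₂' : ∀ᵐ p : ℝ × ℝ, p ∈ upperHalf → lineDeriv ℝ W p (0, 1) = -f (v p.1 p.2) := by
    filter_upwards [hW₂] with p hp hpH
    rw [hp hpH, indicator_of_mem hpH]
  -- the spatial increments agree with the integrals of `v` at almost every time, hence at
  -- arbitrarily small times
  have hinit : ∀ a b, W (b, 0) - W (a, 0) = ∫ x in a..b, φ x := by
    intro a b
    have hlim : ∀ x : ℝ, Tendsto (fun t => W (x, t)) (𝓝[>] 0) (𝓝 (W (x, 0))) := fun x =>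
      ((hW.continuous.comp (Continuous.prodMk_right x)).tendsto 0).mono_left nhdsWithin_le_nhds
    refine tendsto_nhds_unique_of_frequently_eq ((hlim b).sub (hlim a)) (hv.initial a b).2 ?_
    rw [(nhdsGT_basis (0 : ℝ)).frequently_iff]
    intro ε hε
    obtain ⟨t, ht, htε⟩ := (Measure.dense_of_ae
      (ae_intervalIntegral_eq_sub hW hW₁')).exists_between hε
    exact ⟨t, htε, (ht htε.1 a b).symm⟩
  refine ⟨K, fun p => W p - W (0, 0), ?_, ?_, ?_, fun x => hinit 0 x, ?_⟩
  · exact LipschitzWith.of_dist_le_mul fun p q => by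
      rw [dist_sub_right]; exact hW.dist_le_mul p q
  · simpa only [lineDeriv, deriv_sub_const] using hW₁'
  · simpa only [lineDeriv, deriv_sub_const] using hW₂'
  · intro c p hp s hs
    have hps : p + s • (deriv f c, (1 : ℝ)) ∈ upperHalf := by
      have : 0 < p.2 := hp
      simpa [upperHalf] using (by linarith : 0 < p.2 + s)
    have := hWd (s • (deriv f c, 1)) (s * legendre f c) (Eventually.of_forall fun q hq => ?_)
      p hp hps
    · linarith
    · rw [indicator_of_mem hq, indicator_of_mem hq]
      have e := mul_le_mul_of_nonneg_left
        (tangent_le h.differentiable h.strictMono (v q.1 q.2) c) hs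
      simp only [Prod.smul_mk, smul_eq_mul, mul_one]
      unfold legendre
      linarith

/-- Any function whose increments along lines of characteristic speed are bounded by the Legendre
transform lies below the value function. -/
theorem IsAdmissible.le_value {f φ : ℝ → ℝ} {M : ℝ} (h : IsAdmissible f φ M) {W : ℝ × ℝ → ℝ}
    (hW : Continuous W) (hW0 : ∀ x, W (x, 0) = prim φ x)
    (hWd : ∀ c, ∀ p ∈ upperHalf, ∀ s, 0 ≤ s →
      W (p + s • (deriv f c, 1)) ≤ W p + s * legendre f c) {x t : ℝ} (ht : 0 < t) :
    W (x, t) ≤ value f φ M (x, t) := by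
  obtain ⟨c, -, hc⟩ := h.exists_value_eq (x, t)
  rw [← hc]
  unfold action
  rw [← hW0]
  have hlim : Tendsto (fun τ => W (x - (t - τ) * deriv f c, τ) + (t - τ) * legendre f c) (𝓝[>] 0)
      (𝓝 (W (x - t * deriv f c, 0) + t * legendre f c)) := by
    have : Continuous fun τ => W (x - (t - τ) * deriv f c, τ) + (t - τ) * legendre f c := by
      fun_prop
    simpa using (this.tendsto 0).mono_left nhdsWithin_le_nhds
  refine ge_of_tendsto hlim ?_
  filter_upwards [Ioo_mem_nhdsGT ht] with τ hτ
  have := hWd c (x - (t - τ) * deriv f c, τ) hτ.1 (t - τ) (by linarith [hτ.2])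
  simpa using this

/-- The potential of an entropy solution is the value function. -/
theorem IsAdmissible.value_eq_potential {f φ : ℝ → ℝ} {M : ℝ} (h : IsAdmissible f φ M)
    {v : ℝ → ℝ → ℝ} (hv : IsEntropySolution f φ v) {K : NNReal} {W : ℝ × ℝ → ℝ}
    (hW : LipschitzWith K W)
    (hW₁ : ∀ᵐ p : ℝ × ℝ, p ∈ upperHalf → lineDeriv ℝ W p (1, 0) = v p.1 p.2)
    (hW₂ : ∀ᵐ p : ℝ × ℝ, p ∈ upperHalf → lineDeriv ℝ W p (0, 1) = -f (v p.1 p.2))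
    (hW0 : ∀ x, W (x, 0) = prim φ x)
    (hWd : ∀ c, ∀ p ∈ upperHalf, ∀ s, 0 ≤ s →
      W (p + s • (deriv f c, 1)) ≤ W p + s * legendre f c) {p : ℝ × ℝ} (hp : p ∈ upperHalf) :
    value f φ M p = W p := by
  refine le_antisymm ?_ (h.le_value hW.continuous hW0 hWd hp)
  obtain ⟨L, hL⟩ := h.exists_lipschitzWith_value
  obtain ⟨M', hM'⟩ := hv.bounded
  obtain ⟨A, hA⟩ := isCompact_Icc.exists_bound_of_continuousOn (s := Icc (-M') M')
    h.continuous_deriv.continuousOn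
  -- `z` is the difference of the potentials, frozen at its zero initial value for `t ≤ 0`
  set ρ : ℝ × ℝ → ℝ × ℝ := fun p => (p.1, max p.2 0) with hρ
  have hρL : LipschitzWith 1 ρ := by
    simpa using! LipschitzWith.prod_fst.prodMk lipschitzWith_max_snd
  have hρe : ∀ p ∈ upperHalf, ρ =ᶠ[𝓝 p] id := by
    intro p hp
    filter_upwards [isOpen_upperHalf.mem_nhds hp] with q hq
    simp only [hρ, max_eq_left (le_of_lt hq : 0 ≤ q.2), id]
  set z : ℝ × ℝ → ℝ := fun p => value f φ M (ρ p) - W (ρ p) with hz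
  have hzL : LipschitzWith (L * 1 + K * 1) z := (hL.comp hρL).sub (hW.comp hρL)
  have hze : ∀ p ∈ upperHalf, z =ᶠ[𝓝 p] fun q => value f φ M q - W q := by
    intro p hp
    filter_upwards [hρe p hp] with q hq
    simp only [hz, hq, id]
  have key := nonpos_of_transport hzL (g := fun p => deriv f (v p.1 p.2)) (A := A) ?_ ?_ ?_ ?_ ?_
    p hp
  · rw [(hze p hp).self_of_nhds] at key
    linarith
  · intro p hp
    simp only [hz, hρ, max_eq_right hp, h.value_zero, hW0, sub_self]
  · exact (h.continuous_deriv.measurable.comp_aemeasurable hv.measurable).aestronglyMeasurable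
  · intro p hp
    exact hA _ (abs_le.1 (hM' p.1 p.2 hp))
  · intro x₁ x₂ t hx ht
    exact hv.oleinik x₁ x₂ t hx ht
  · filter_upwards [hL.ae_differentiableAt, hW.ae_differentiableAt, h.ae_lineDeriv_value, hW₁, hW₂]
      with p d₁ d₂ e₁ e₂ e₃ hp
    have e₁ := e₁ hp
    have e₂ := e₂ hp
    have e₃ := e₃ hp
    rw [d₁.lineDeriv_eq_fderiv, d₁.lineDeriv_eq_fderiv] at e₁
    rw [d₂.lineDeriv_eq_fderiv] at e₂ e₃
    have hd := (d₁.hasFDerivAt.sub d₂.hasFDerivAt).congr_of_eventuallyEq (hze p hp)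
    refine ⟨hd.differentiableAt, ?_⟩
    rw [hd.fderiv]
    have hdir : ((deriv f (v p.1 p.2), 1) : ℝ × ℝ) =
        deriv f (v p.1 p.2) • ((1, 0) : ℝ × ℝ) + (0, 1) := by simp
    rw [hdir, map_add, map_smul]
    simp only [sub_apply, e₁.1, e₁.2, e₂, e₃, smul_eq_mul]
    have := tangent_le h.differentiable h.strictMono (uPlus f φ p.1 p.2) (v p.1 p.2)
    linarith

theorem IsAdmissible.ae_eq_uPlus {f φ : ℝ → ℝ} {M : ℝ} (h : IsAdmissible f φ M)
    {v : ℝ → ℝ → ℝ} (hv : IsEntropySolution f φ v) :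
    ∀ᵐ p ∂(volume.restrict upperHalf), v p.1 p.2 = uPlus f φ p.1 p.2 := by
  obtain ⟨K, W, hW, hW₁, hW₂, hW0, hWd⟩ := hv.toIsWeakSolution.exists_potential h
  rw [ae_restrict_iff' measurableSet_upperHalf]
  filter_upwards [hW₁, h.ae_lineDeriv_value] with p e₁ e₂ hp
  rw [← e₁ hp, ← (e₂ hp).1]
  refine Filter.EventuallyEq.lineDeriv_eq ?_
  filter_upwards [isOpen_upperHalf.mem_nhds hp] with q hq
  exact (h.value_eq_potential hv hW hW₁ hW₂ hW0 hWd hq).symm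

end ScalarLaw

theorem theorem2p1 (f φ : ℝ → ℝ) (hf : ContDiff ℝ 2 f)
    (hconv : ∀ u : ℝ, 0 ≤ deriv (deriv f) u)
    (hnull : volume {u : ℝ | deriv (deriv f) u = 0} = 0)
    (hφ : MemLp φ ⊤ volume) :
    -- the formula makes sense at every point of the open upper half-plane
    (∀ x t : ℝ, 0 < t →
      (∀ w : ℝ, IntervalIntegrable
        (fun s => deriv (deriv f) s * (φ (x - t * deriv f s) - s)) volume 0 w) ∧
      (ScalarLaw.maximizers f φ x t).Nonempty ∧ IsCompact (ScalarLaw.maximizers f φ x t)) ∧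
    -- it gives an entropy solution
    ScalarLaw.IsEntropySolution f φ (ScalarLaw.uPlus f φ) ∧
    -- which is the only one, up to equality almost everywhere
    (∀ v : ℝ → ℝ → ℝ, ScalarLaw.IsEntropySolution f φ v →
      ∀ᵐ p ∂(volume.restrict ScalarLaw.upperHalf), v p.1 p.2 = ScalarLaw.uPlus f φ p.1 p.2) ∧
    -- left and right traces
    (∀ x t : ℝ, 0 < t →
      Tendsto (fun y => ScalarLaw.uPlus f φ y t) (𝓝[<] x) (𝓝 (ScalarLaw.uMinus f φ x t)) ∧
      Tendsto (fun y => ScalarLaw.uPlus f φ y t) (𝓝[>] x) (𝓝 (ScalarLaw.uPlus f φ x t))) ∧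
    -- for each `t > 0` the traces agree off a countable set, on which the left one is larger
    (∀ t : ℝ, 0 < t → ∃ S : Set ℝ, S.Countable ∧
      (∀ x : ℝ, x ∉ S → ScalarLaw.uMinus f φ x t = ScalarLaw.uPlus f φ x t ∧
        ContinuousAt (fun y => ScalarLaw.uPlus f φ y t) x) ∧
      (∀ x ∈ S, ScalarLaw.uPlus f φ x t < ScalarLaw.uMinus f φ x t)) ∧
    -- `f'(u(·, t))` is locally of bounded variation
    (∀ t : ℝ, 0 < t →
      LocallyBoundedVariationOn (fun x => deriv f (ScalarLaw.uPlus f φ x t)) univ) := by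
  obtain ⟨M, h⟩ := ScalarLaw.exists_isAdmissible hf hconv hnull hφ
  exact ⟨fun x t ht => ⟨fun w => (h.intervalIntegrable_integrand x ht w).1,
      h.maximizers_nonempty x ht, h.isCompact_maximizers x ht⟩,
    h.isEntropySolution_uPlus, fun v hv => h.ae_eq_uPlus hv,
    fun x t ht => ⟨h.tendsto_uPlus_left x ht, h.tendsto_uPlus_right x ht⟩,
    fun t ht => h.exists_jumps ht,
    fun t ht => h.locallyBoundedVariationOn_deriv_uPlus ht⟩
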